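/- Let $n,r\ge 0$ be integers with $2r\le n$, let $s\in\mathbb C$, and let $\lambda=(\lambda_1\ge\dots\ge\lambda_r\ge 0)$ be a partition with at most $r$ parts; write $|\lambda|=\sum_i\lambda_i$. *Interpolation polynomials.* For generic $q,t,a$ let $P^{\mathrm{ip}}_\lambda(x;q,t,a)$ be the unique Laurent polynomial in $x_1,\dots,x_r$ of degree $|\lambda|$ that is invariant under permutations and inversions $x_i\mapsto x_i^{-1}$ of the variables, in which $x_1^{\lambda_1}\cdots x_r^{\lambda_r}$ has coefficient $1$, and which satisfies $P^{\mathrm{ip}}_\lambda(aq^{\mu_1}t^{r-1},\dots,aq^{\mu_r}t^{0};q,t,a)=0$ for every partition $\mu=(\mu_1\ge\dots\ge\mu_r\ge0)$ with $\lambda\not\subseteq\mu$. The Okounkov type BC interpolation polynomial is $$P_\lambda(x;\tau;\alpha)=\lim_{q\uparrow1}(1-q)^{-2|\lambda|}P^{\mathrm{ip}}_\lambda(q^{x_1},\dots,q^{x_r};q,q^\tau,q^\alpha),$$ a polynomial in $x$ whose coefficients are rational functions of $\tau,\alpha$; where the limit is not available at a non-generic value of $\alpha$, the value there is that of these rational functions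 (the limit from nearby $\alpha$). *Restricted Casimir polynomials.* Let $\rho_i=\frac{n-(2i-1)}2$ for $1\le i\le n$. The eigenvalue of the $p$-th Casimir operator of $\mathfrak{gl}_n$ on the irreducible module of highest weight $\nu=(\nu_1,\dots,\nu_n)$ is $$c_p(\nu)=\sum_{i=1}^n\Bigl(\nu_i+\rho_i+\tfrac{n-1}2\Bigr)^p\prod_{j\ne i}\Bigl(1-\frac1{\nu_i-\nu_j+\rho_i-\rho_j}\Bigr).$$ Let $C_p\in\mathbb C[x_1,\dots,x_r]$ be the polynomial with $C_p(x_1,\dots,x_r)=c_p(x_1,\dots,x_r,0,\dots,0,-x_r,\dots,-x_1)$ (with $n-2r$ zeros) for all real $x_1\ge\dots\ge x_r\ge0$. For a partition $\mu$ with (positive) parts $\mu_1\ge\dots\ge\mu_\ell>0$ put $\ell(\mu)=\ell$ and $C_{2\mu}=C_{2\mu_1}\cdots C_{2\mu_\ell}$. *Theorem.* Let $s_\lambda(x_1,\dots,x_r)=\det(x_i^{\lambda_j+r-j})/\det(x_i^{r-j})$ be the Schur polynomial, let $p_\mu=p_{\mu_1}\cdots p_{\mu_\ell}$ be the power sum symmetric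 polynomials in $x_1,\dots,x_r$, and let $a_\mu\in\mathbb C$, for $\mu$ running over all partitions of $|\lambda|$, be any coefficients with $s_\lambda=\sum_{\mu\vdash|\lambda|}a_\mu p_\mu$. Then, as polynomials in $x=(x_1,\dots,x_r)$, $$P_\lambda\Bigl(x_1+\rho_1,\dots,x_r+\rho_r;\,1;\,s-\frac{n-1}2\Bigr)=\sum_{\mu\vdash|\lambda|}\frac{a_\mu}{2^{\ell(\mu)}}\,C_{2\mu}+L(x),$$ where every monomial of $L$ has total degree strictly less than $2|\lambda|$. -/

import Mathlib

open Filter Topology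

noncomputable section

namespace OkounkovCasimir

/-! Partitions with at most `r` parts are weakly decreasing functions `Fin r → ℕ`; indices start
at `0`, so that the usual index `i` is `i + 1` here. -/

/-! ### Okounkov's Laurent polynomials -/

/-- The value of a Laurent polynomial in `r` variables at a point. -/
def laurentEval {r : ℕ} (P : AddMonoidAlgebra ℂ (Fin r → ℤ)) (x : Fin r → ℂ) : ℂ :=
  P.coeff.sum fun m c => c * ∏ i, x i ^ m i

/-- The point `a q^μ t^δ`, where `δ = (r - 1, …, 1, 0)`. -/
def interpNode {r : ℕ} (q t a : ℂ) (mu : Fin r → ℕ) : Fin r → ℂ :=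
  fun i => a * q ^ mu i * t ^ (r - 1 - (i : ℕ))

/-- The properties that characterize Okounkov's interpolation Laurent polynomial
`P^ip_λ(x; q, t, a)`, for generic values of the parameters `q`, `t`, `a`. -/
structure IsOkounkovIP {r : ℕ} (q t a : ℂ) (lam : Fin r → ℕ)
    (P : AddMonoidAlgebra ℂ (Fin r → ℤ)) : Prop where
  /-- `P` has degree at most `|λ|` (exactly `|λ|`, in view of `monic`). -/
  degree_le : ∀ m ∈ P.coeff.support, ∑ i, m i ≤ ∑ i, (lam i : ℤ)
  /-- The coefficient of `x^λ` is `1`. -/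
  monic : P.coeff (fun i => (lam i : ℤ)) = 1
  /-- Invariance under permutations of the variables. -/
  perm_invariant : ∀ (w : Equiv.Perm (Fin r)) (m : Fin r → ℤ),
    P.coeff (fun i => m (w i)) = P.coeff m
  /-- Invariance under inversions `x_i ↦ x_i⁻¹` of some of the variables. -/
  inv_invariant : ∀ (e : Fin r → ℤˣ) (m : Fin r → ℤ),
    P.coeff (fun i => (e i : ℤ) * m i) = P.coeff m
  /-- The vanishing condition: `P(a q^μ t^δ) = 0` for all partitions `μ` unless `λ ⊆ μ`. -/
  vanishing : ∀ mu : Fin r → ℕ, Antitone mu → ¬ (∀ i, lam i ≤ mu i) →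
    laurentEval P (interpNode q t a mu) = 0

open Classical in
/-- Okounkov's interpolation Laurent polynomial `P^ip_λ(x; q, t, a)`: the unique Laurent polynomial
with the above properties (and `0` for the special parameters where it is not unique or does not
exist). -/
def okounkovIP {r : ℕ} (q t a : ℂ) (lam : Fin r → ℕ) : AddMonoidAlgebra ℂ (Fin r → ℤ) :=
  if h : ∃! P, IsOkounkovIP q t a lam P then h.choose else 0

/-- `P` is the limit of `(1 - q)^(-2|λ|) P^ip_λ(q^x; q, q^τ, q^α)` as `q` increases to `1`,
at every point `x`. -/
def IsInterpLimit {r : ℕ} (tau alpha : ℂ) (lam : Fin r → ℕ) (P : MvPolynomial (Fin r) ℂ) : Prop :=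
  ∀ x : Fin r → ℂ, Tendsto
    (fun q : ℝ => ((1 - (q : ℂ)) ^ (2 * ∑ i, lam i))⁻¹ *
      laurentEval (okounkovIP (q : ℂ) ((q : ℂ) ^ tau) ((q : ℂ) ^ alpha) lam)
        (fun i => (q : ℂ) ^ x i))
    (𝓝[<] 1) (𝓝 (MvPolynomial.eval x P))

/-- `P` is the value at `(τ, α)` of the interpolation polynomial `P_λ(x; τ; α)`, whose coefficients
are rational functions of the parameters. For special values of `α` (when `q^α` is not generic)
the limit `q ↑ 1` is not available at `α` itself; the value there is that of the rational functions,
that is, the limit from the nearby parameters `β ≠ α`. -/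
def IsBCInterp {r : ℕ} (tau alpha : ℂ) (lam : Fin r → ℕ) (P : MvPolynomial (Fin r) ℂ) : Prop :=
  ∃ Q : ℂ → MvPolynomial (Fin r) ℂ,
    (∀ᶠ beta in 𝓝[≠] alpha, IsInterpLimit tau beta lam (Q beta)) ∧
    ∀ x : Fin r → ℂ,
      Tendsto (fun beta => MvPolynomial.eval x (Q beta)) (𝓝[≠] alpha) (𝓝 (MvPolynomial.eval x P))

open Classical in
/-- The Okounkov type BC interpolation polynomial `P_λ(x; τ; α)` in `r` variables. -/
def bcInterp {r : ℕ} (tau alpha : ℂ) (lam : Fin r → ℕ) : MvPolynomial (Fin r) ℂ :=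
  if h : ∃! P, IsBCInterp tau alpha lam P then h.choose else 0

/-! ### Restricted Casimir polynomials -/

/-- Half the sum of the positive roots of `gl_n`, with entries `(n - (2 i - 1)) / 2`,
`i = 1, …, n`. -/
def rhoCoord (n i : ℕ) : ℂ := ((n : ℂ) - (2 * (i : ℂ) + 1)) / 2

/-- The eigenvalue `c_p(λ)` of the `p`-th Casimir operator of `gl_n` on the module of highest
weight `λ`; no denominator vanishes when `λ` is dominant. -/
def casimirEigenvalue (n p : ℕ) (lam : Fin n → ℂ) : ℂ :=
  ∑ i : Fin n,
    (∏ j ∈ Finset.univ.erase i,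
      (1 - 1 / (lam i - lam j + rhoCoord n i - rhoCoord n j))) *
    (lam i + rhoCoord n i + ((n : ℂ) - 1) / 2) ^ p

/-- The weight `(x_1, …, x_r, 0, …, 0, -x_r, …, -x_1)` of `gl_n` (for `2 r ≤ n`). -/
def restrictedWeight (n : ℕ) {r : ℕ} (x : Fin r → ℂ) : Fin n → ℂ := fun i =>
  if h : (i : ℕ) < r then x ⟨i, h⟩
  else if h' : n - 1 - (i : ℕ) < r then -x ⟨n - 1 - (i : ℕ), h'⟩
  else 0

open Classical in
/-- The restricted Casimir polynomial `C_p(x_1, …, x_r)`: the unique polynomial that gives the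
eigenvalue of the `p`-th Casimir operator at the weight `(x_1, …, x_r, 0, …, 0, -x_r, …, -x_1)`
for all real `x_1 ≥ … ≥ x_r ≥ 0`. -/
def restrictedCasimir (n r p : ℕ) : MvPolynomial (Fin r) ℂ :=
  if h : ∃! P : MvPolynomial (Fin r) ℂ, ∀ x : Fin r → ℝ, Antitone x → (∀ i, 0 ≤ x i) →
      MvPolynomial.eval (fun i => (x i : ℂ)) P =
        casimirEigenvalue n p (restrictedWeight n fun i => (x i : ℂ))
  then h.choose else 0

/-- `C_{2μ}`: the product of the restricted Casimir polynomials `C_{2 μ_i}` over the (positive)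
parts of the partition `μ`. -/
def restrictedCasimirTwice (n r : ℕ) {d : ℕ} (mu : d.Partition) : MvPolynomial (Fin r) ℂ :=
  (mu.parts.map fun k => restrictedCasimir n r (2 * k)).prod

/-! ### Schur polynomials -/

/-- The alternant `det (x_i^(ν_j))`. -/
def alternant {r : ℕ} (nu : Fin r → ℕ) : MvPolynomial (Fin r) ℂ :=
  (Matrix.of fun i j : Fin r => (MvPolynomial.X i : MvPolynomial (Fin r) ℂ) ^ nu j).det

open Classical in
/-- The Schur polynomial `s_λ` in `r` variables: the quotient of
`det (x_i^(λ_j + r - j))` by the Vandermonde determinant `det (x_i^(r - j))`. -/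
def schurPolynomial {r : ℕ} (lam : Fin r → ℕ) : MvPolynomial (Fin r) ℂ :=
  if h : ∃! S : MvPolynomial (Fin r) ℂ,
      S * alternant (fun j : Fin r => r - 1 - (j : ℕ)) =
        alternant (fun j : Fin r => lam j + (r - 1 - (j : ℕ)))
  then h.choose else 0

/-- The polynomial `P(μ + ρ)` in `μ = (μ_1, …, μ_r)`, where `ρ_i = (n - (2 i - 1)) / 2`. -/
def shiftByRho (n : ℕ) {r : ℕ} (P : MvPolynomial (Fin r) ℂ) : MvPolynomial (Fin r) ℂ :=
  MvPolynomial.bind₁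
    (fun i : Fin r => (MvPolynomial.X i + MvPolynomial.C (rhoCoord n i) : MvPolynomial (Fin r) ℂ)) P

end OkounkovCasimir

end

/-! Both sides turn out to have the top homogeneous part `s_λ(x_1², …, x_r²)`, of degree `2|λ|`.

Interpolation side. `τ = 1` means `t = q`. A Laurent polynomial invariant under inversions is a
polynomial in `z_i = x_i + x_i⁻¹`, and the nodes become `η_{μ_i + r - i}` with `η_l = a q^l + (a
q^l)⁻¹`. The vanishing conditions then single out the factorial Schur polynomial `s_λ(z | η)`
(`okounkovIP_self`). Replacing variables and shifts simultaneously by `u z + v`, `u η + v`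
multiplies it by `u^|λ|`. With `u = (1 - q)²` and `v = 2` this absorbs the normalization, and since
`(q^c + q^(-c) - 2) / (1 - q)² → c²`, the limit is `s_λ(x² | (α + l)²)` (`bcInterp_one`). The shifts
`(α + l)²` and the translation by `ρ` affect only lower degrees.

Casimir side. Let `y_j` be the shifted coordinates of the weight. By partial fractions, `∑ c_p
v^(p+1) = 1 - ∏ (1 - v / (1 - y_j v))` (`coeff_casimirSeries`). So `c_p` is a polynomial in the
`y_j` with leading part `∑ y_j^p`, which for `p = 2k > 0` on the restricted weight is `2 p_k(x²)`.
Hence `C_{2μ}` has leading part `2^ℓ(μ) p_μ(x²)`, and the expansion of `s_λ` in power sums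
concludes. -/

noncomputable section

namespace OkounkovCasimir

/-! ### Calculus of leading parts modulo lower degree -/

section DegreeFiltration

open MvPolynomial

/-! ### The degree filtration -/

/-- The polynomials all of whose monomials have degree less than `N`. -/
def degreeLT (r N : ℕ) : Submodule ℂ (MvPolynomial (Fin r) ℂ) :=
  restrictSupport ℂ {m | m.degree < N}

variable {r : ℕ}

lemma mem_degreeLT {N : ℕ} {p : MvPolynomial (Fin r) ℂ} :
    p ∈ degreeLT r N ↔ ∀ m ∈ p.support, m.degree < N := by
  rw [degreeLT, mem_restrictSupport_iff]; rfl

lemma degreeLT_mono {M N : ℕ} (h : M ≤ N) : degreeLT r M ≤ degreeLT r N := fun p hp => by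
  rw [mem_degreeLT] at *
  exact fun m hm => (hp m hm).trans_le h

/-- One strict and one weak degree bound add up to a strict bound; for `M + 1` in place of `M` this
also covers two weak bounds. -/
lemma mul_mem_degreeLT {M N : ℕ} {p q : MvPolynomial (Fin r) ℂ} (hp : p ∈ degreeLT r M)
    (hq : q ∈ degreeLT r (N + 1)) : p * q ∈ degreeLT r (M + N) := by
  classical
  rw [mem_degreeLT] at *
  intro m hm
  obtain ⟨a, ha, b, hb, rfl⟩ := Finset.mem_add.1 (support_mul p q hm)
  have := hp a ha
  have := hq b hb
  rw [map_add]
  omega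

lemma totalDegree_le_of_mem_degreeLT {N : ℕ} {p : MvPolynomial (Fin r) ℂ}
    (hp : p ∈ degreeLT r (N + 1)) : p.totalDegree ≤ N := by
  rw [mem_degreeLT] at hp
  rw [totalDegree_eq]
  refine Finset.sup_le fun m hm => ?_
  have := hp m hm
  rw [Finsupp.card_toMultiset]
  exact Nat.lt_succ_iff.1 this

lemma C_mem_degreeLT {N : ℕ} (c : ℂ) : C c ∈ degreeLT r (N + 1) := by
  classical
  rw [mem_degreeLT]
  intro m hm
  rw [mem_support_iff, coeff_C] at hm
  have : 0 = m := by by_contra h; simp [h] at hm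
  subst this; simp

lemma X_mem_degreeLT (i : Fin r) : X i ∈ degreeLT r 2 := by
  classical
  rw [mem_degreeLT]
  intro m hm
  rw [support_X, Finset.mem_singleton] at hm
  subst hm; simp

/-- `p` has degree at most `N`, and `p` and `h` have the same homogeneous component of
degree `N`. -/
structure SameTop (N : ℕ) (p h : MvPolynomial (Fin r) ℂ) : Prop where
  mem : p ∈ degreeLT r (N + 1)
  sub_mem : p - h ∈ degreeLT r N

namespace SameTop

variable {N M : ℕ} {p h p' h' : MvPolynomial (Fin r) ℂ}

lemma refl (hp : p ∈ degreeLT r (N + 1)) : SameTop N p p := ⟨hp, by simp⟩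

lemma mem_right (H : SameTop N p h) : h ∈ degreeLT r (N + 1) := by
  have := Submodule.sub_mem _ H.mem (degreeLT_mono N.le_succ H.sub_mem)
  simpa using this

lemma symm (H : SameTop N p h) : SameTop N h p :=
  ⟨H.mem_right, by simpa using Submodule.neg_mem _ H.sub_mem⟩

lemma trans (H : SameTop N p h) (H' : SameTop N h h') : SameTop N p h' :=
  ⟨H.mem, by simpa using Submodule.add_mem _ H.sub_mem H'.sub_mem⟩

lemma mul (H : SameTop N p h) (H' : SameTop M p' h') : SameTop (N + M) (p * p') (h * h') := by
  refine ⟨?_, ?_⟩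
  · have := mul_mem_degreeLT H.mem H'.mem
    rwa [add_right_comm] at this
  · have e : p * p' - h * h' = (p' - h') * p + (p - h) * h' := by ring
    rw [e]
    refine Submodule.add_mem _ ?_ (mul_mem_degreeLT H.sub_mem H'.mem_right)
    rw [add_comm N M]
    exact mul_mem_degreeLT H'.sub_mem H.mem

lemma const (c : ℂ) : SameTop (r := r) 0 (C c) (C c) := refl (C_mem_degreeLT c)

lemma C_mul (c : ℂ) (H : SameTop N p h) : SameTop N (C c * p) (C c * h) := by
  simpa using (const c).mul H

lemma neg (H : SameTop N p h) : SameTop N (-p) (-h) := by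
  simpa using H.C_mul (-1)

lemma zsmul_unit (u : ℤˣ) (H : SameTop N p h) : SameTop N (u • p) (u • h) := by
  rcases Int.units_eq_one_or u with rfl | rfl
  · simpa using H
  · simpa using H.neg

lemma sum {ι : Type*} (s : Finset ι) {f g : ι → MvPolynomial (Fin r) ℂ}
    (H : ∀ i ∈ s, SameTop N (f i) (g i)) : SameTop N (∑ i ∈ s, f i) (∑ i ∈ s, g i) :=
  ⟨Submodule.sum_mem _ fun i hi => (H i hi).mem, by
    rw [← Finset.sum_sub_distrib]
    exact Submodule.sum_mem _ fun i hi => (H i hi).sub_mem⟩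

lemma prod {ι : Type*} (s : Finset ι) {d : ι → ℕ} {f g : ι → MvPolynomial (Fin r) ℂ}
    (H : ∀ i ∈ s, SameTop (d i) (f i) (g i)) :
    SameTop (∑ i ∈ s, d i) (∏ i ∈ s, f i) (∏ i ∈ s, g i) := by
  classical
  induction s using Finset.induction_on with
  | empty => simpa using const (r := r) 1
  | insert a s ha ih =>
    rw [Finset.sum_insert ha, Finset.prod_insert ha, Finset.prod_insert ha]
    exact (H a (by simp)).mul (ih fun i hi => H i (by simp [hi]))

lemma multiset_prod {ι : Type*} (s : Multiset ι) {d : ι → ℕ} {f g : ι → MvPolynomial (Fin r) ℂ}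
    (H : ∀ i ∈ s, SameTop (d i) (f i) (g i)) :
    SameTop (s.map d).sum (s.map f).prod (s.map g).prod := by
  induction s using Multiset.induction_on with
  | empty => simpa using const (r := r) 1
  | cons a s ih =>
    simp only [Multiset.map_cons, Multiset.sum_cons, Multiset.prod_cons]
    exact (H a (by simp)).mul (ih fun i hi => H i (by simp [hi]))

lemma pow (H : SameTop N p h) (k : ℕ) : SameTop (k * N) (p ^ k) (h ^ k) := by
  simpa using prod (Finset.range k) (d := fun _ => N) fun _ _ => H

lemma X_add_C (i : Fin r) (c : ℂ) : SameTop 1 (X i + C c) (X i) := by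
  refine ⟨Submodule.add_mem _ (X_mem_degreeLT i) (C_mem_degreeLT c), ?_⟩
  simpa using C_mem_degreeLT c

end SameTop

/-- Substituting polynomials with leading terms `h_i` for the variables of `p` gives, up to terms
of lower degree, the substitution of the `h_i`. -/
lemma sameTop_aeval {N d : ℕ} {g h : Fin r → MvPolynomial (Fin r) ℂ}
    (H : ∀ i, SameTop d (g i) (h i)) {p : MvPolynomial (Fin r) ℂ} (hp : p ∈ degreeLT r (N + 1))
    (hd : 0 < d) :
    SameTop (d * N) (aeval g p) (aeval h p) := by
  rw [p.as_sum, map_sum, map_sum]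
  refine SameTop.sum _ fun m hm => ?_
  have hm' : m.degree ≤ N := Nat.lt_succ_iff.1 (mem_degreeLT.1 hp m hm)
  have key : SameTop (d * m.degree) (aeval g (monomial m (coeff m p)))
      (aeval h (monomial m (coeff m p))) := by
    rw [aeval_monomial, aeval_monomial, algebraMap_eq]
    refine SameTop.C_mul _ ?_
    rw [Finsupp.prod_fintype _ _ (by simp), Finsupp.prod_fintype _ _ (by simp),
      Finsupp.degree_eq_sum, Finset.mul_sum]
    refine SameTop.prod _ fun i _ => ?_
    rw [mul_comm]
    exact (H i).pow _
  -- Only monomials of degree exactly `N` matter: for the others both images already have degree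
  -- below `d * N`.
  rcases hm'.eq_or_lt with e | l
  · rwa [← e]
  · have l' : d * m.degree + 1 ≤ d * N := Nat.mul_lt_mul_of_pos_left l hd
    exact ⟨degreeLT_mono (by omega) key.mem, degreeLT_mono l'
      (Submodule.sub_mem _ key.mem key.mem_right)⟩

lemma aeval_mem_degreeLT {N d : ℕ} {h : Fin r → MvPolynomial (Fin r) ℂ}
    (H : ∀ i, h i ∈ degreeLT r (d + 1)) {p : MvPolynomial (Fin r) ℂ} (hp : p ∈ degreeLT r N)
    (hd : 0 < d) : aeval h p ∈ degreeLT r (d * N) := by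
  rcases N with _ | N
  · have : p = 0 := by
      rw [mem_degreeLT] at hp
      rw [← support_eq_empty]
      exact Finset.eq_empty_of_forall_notMem fun m hm => absurd (hp m hm) (by simp)
    simp [this]
  · refine degreeLT_mono ?_ (sameTop_aeval (fun i => SameTop.refl (H i)) hp hd).mem
    rw [mul_add]
    omega

/-- Total degrees add over a domain, and the monomial `m` bounds the degree of `V` below by `e`.
This allows the Vandermonde factor to be cancelled in degree estimates. -/
lemma mem_degreeLT_of_mul_mem {N e : ℕ} {p V : MvPolynomial (Fin r) ℂ} (m : Fin r →₀ ℕ)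
    (hm : coeff m V ≠ 0) (he : m.degree = e) (h : p * V ∈ degreeLT r (N + e)) :
    p ∈ degreeLT r N := by
  have hV : V ≠ 0 := by rintro rfl; simp at hm
  rcases eq_or_ne p 0 with rfl | hp
  · simp
  have h1 := totalDegree_mul_of_isDomain hp hV
  have h2 : e ≤ V.totalDegree := by
    rw [← he, Finsupp.degree_eq_sum]
    have := le_totalDegree (mem_support_iff.2 hm)
    rwa [Finsupp.sum_fintype _ _ (by simp)] at this
  have hpV : p * V ≠ 0 := mul_ne_zero hp hV
  have h3 : (p * V).totalDegree < N + e := by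
    have hpos : 0 < N + e := by
      obtain ⟨m', hm'⟩ := support_nonempty.2 hpV
      exact (Nat.zero_le _).trans_lt (mem_degreeLT.1 h m' hm')
    have : p * V ∈ degreeLT r (N + e - 1 + 1) := by rwa [Nat.sub_add_cancel hpos]
    have := totalDegree_le_of_mem_degreeLT this
    omega
  rw [mem_degreeLT]
  intro m' hm'
  have := le_totalDegree hm'
  rw [Finsupp.sum_fintype _ _ (by simp)] at this
  rw [Finsupp.degree_eq_sum]
  omega

end DegreeFiltration

/-! ### Vandermonde quotients: Schur and factorial Schur polynomials -/

section Alternants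

/-! ### Alternants -/

section Vandermonde

open Polynomial

variable {R : Type*} [CommRing R]

lemma det_vandermonde_succ {r : ℕ} (z : Fin (r + 1) → R) :
    (Matrix.vandermonde z).det =
      (∏ i : Fin r, (z i.succ - z 0)) * (Matrix.vandermonde fun i : Fin r => z i.succ).det := by
  rw [Matrix.det_vandermonde, Matrix.det_vandermonde, Fin.prod_univ_succ, Fin.prod_Ioi_zero]
  simp only [Fin.prod_Ioi_succ]

/-- The Vandermonde determinant divides every determinant `det (f_j(z_i))`. -/
lemma det_vandermonde_dvd {r : ℕ} (f : Fin r → R[X]) (z : Fin r → R) :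
    (Matrix.vandermonde z).det ∣ (Matrix.of fun i j => (f j).eval (z i)).det := by
  induction r with
  | zero => simp
  | succ r ih =>
    -- Subtracting row `0` from every other row turns the entries into `f_j(z_i) - f_j(z_0) = (z_i -
    -- z_0) g_j(z_i)`. The factors `z_i - z_0` come out of each minor along row `0`, and induction
    -- applies to the `g_j`.
    choose g hg using fun j => Polynomial.X_sub_C_dvd_sub_C_eval (a := z 0) (p := f j)
    have hg' : ∀ j y, (f j).eval y = (y - z 0) * (g j).eval y + (f j).eval (z 0) := fun j y => by
      have := congrArg (Polynomial.eval y) (hg j)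
      simp only [Polynomial.eval_sub, Polynomial.eval_C, Polynomial.eval_mul,
        Polynomial.eval_X] at this
      rw [← this]; ring
    rw [Matrix.det_eq_of_forall_row_eq_smul_add_const
      (B := Matrix.of fun i j => if i = 0 then (f j).eval (z 0) else (z i - z 0) * (g j).eval (z i))
      (A := Matrix.of fun i j => (f j).eval (z i))
      (fun i => if i = 0 then 0 else 1) 0 (by simp),
      Matrix.det_succ_row_zero (Matrix.of fun i j => if i = 0 then _ else _)]
    · refine Finset.dvd_sum fun j _ => Dvd.dvd.mul_left ?_ _
      have e : (Matrix.of fun i j => if i = 0 then (f j).eval (z 0)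
            else (z i - z 0) * (g j).eval (z i)).submatrix Fin.succ j.succAbove =
          Matrix.of fun i j' => (z (Fin.succ i) - z 0) *
            (Matrix.of fun (i : Fin r) j' => (g (j.succAbove j')).eval (z i.succ)) i j' := by
        ext i j'; simp
      rw [e, Matrix.det_mul_column, det_vandermonde_succ]
      exact mul_dvd_mul_left _ (ih _ _)
    · intro i j
      by_cases h : i = 0
      · subst h; simp
      · simp [h, hg' j (z i)]

/-- The determinant `det ((z_i - b_0) ⋯ (z_i - b_{k_j - 1}))`. -/
def factorialAlternant {r : ℕ} (z : Fin r → R) (b : ℕ → R) (k : Fin r → ℕ) : R :=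
  (Matrix.of fun i j : Fin r => ∏ l ∈ Finset.range (k j), (z i - b l)).det

/-- The staircase `(r - 1, …, 1, 0)`. -/
def staircase (r : ℕ) : Fin r → ℕ := fun j => r - 1 - (j : ℕ)

lemma map_factorialAlternant {r : ℕ} {S : Type*} [CommRing S] (φ : R →+* S) (z : Fin r → R)
    (b : ℕ → R) (k : Fin r → ℕ) :
    φ (factorialAlternant z b k) = factorialAlternant (fun i => φ (z i)) (fun l => φ (b l)) k := by
  rw [factorialAlternant, RingHom.map_det, factorialAlternant]
  congr 1
  ext i j
  simp

lemma factorialAlternant_perm {r : ℕ} (w : Equiv.Perm (Fin r)) (z : Fin r → R)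
    (b : ℕ → R) (k : Fin r → ℕ) :
    factorialAlternant (fun i => z (w i)) b k =
      ((Equiv.Perm.sign w : ℤ) : R) * factorialAlternant z b k := by
  rw [factorialAlternant, factorialAlternant, ← Matrix.det_permute]
  rfl

lemma factorialAlternant_zero_staircase {r : ℕ} (z : Fin r → R) :
    factorialAlternant z 0 (staircase r) =
      ((Equiv.Perm.sign (Fin.revPerm (n := r)) : ℤ) : R) * (Matrix.vandermonde z).det := by
  rw [factorialAlternant, ← Matrix.det_permute']
  congr 1
  ext i j
  simp only [Matrix.of_apply, Pi.zero_apply, sub_zero, Finset.prod_const, Finset.card_range,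
    staircase, Matrix.submatrix_apply, Matrix.vandermonde_apply, id, Fin.revPerm_apply,
    Fin.val_rev]
  congr 1
  omega

lemma factorialAlternant_zero_staircase_dvd {r : ℕ} (z : Fin r → R) (b : ℕ → R)
    (k : Fin r → ℕ) : factorialAlternant z 0 (staircase r) ∣ factorialAlternant z b k := by
  have h := det_vandermonde_dvd (fun j => ∏ l ∈ Finset.range (k j), (X - C (b l))) z
  simp only [Polynomial.eval_prod, Polynomial.eval_sub, Polynomial.eval_X,
    Polynomial.eval_C] at h
  rw [factorialAlternant_zero_staircase]
  refine (IsUnit.mul_left_dvd ?_).2 h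
  rcases Int.units_eq_one_or (Equiv.Perm.sign (Fin.revPerm (n := r))) with h | h <;> simp [h]

/-- Unlike in `factorialAlternant_affine`, the shifts stay `0`: a Vandermonde determinant depends
only on differences, so `v` drops out anyway. -/
lemma factorialAlternant_zero_staircase_affine {r : ℕ} (z : Fin r → R) (u v : R) :
    factorialAlternant (fun i => u * z i + v) 0 (staircase r) =
      u ^ (∑ j, staircase r j) * factorialAlternant z 0 (staircase r) := by
  have h1 : factorialAlternant (fun i => u * z i + v) 0 (staircase r) =
      factorialAlternant (fun i => u * z i) 0 (staircase r) := by
    rw [factorialAlternant_zero_staircase, factorialAlternant_zero_staircase,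
      Matrix.det_vandermonde_add]
  rw [h1, factorialAlternant, factorialAlternant, ← Finset.prod_pow_eq_pow_sum,
    ← Matrix.det_mul_row]
  congr 1
  ext i j
  simp [mul_pow]

lemma factorialAlternant_affine {r : ℕ} (z : Fin r → R) (b : ℕ → R) (k : Fin r → ℕ) (u v : R) :
    factorialAlternant (fun i => u * z i + v) (fun l => u * b l + v) k =
      u ^ (∑ j, k j) * factorialAlternant z b k := by
  rw [factorialAlternant, factorialAlternant, ← Finset.prod_pow_eq_pow_sum,
    ← Matrix.det_mul_row]
  congr 1
  ext i j
  simp only [add_sub_add_right_eq_sub, ← mul_sub, Finset.prod_mul_distrib, Matrix.of_apply]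
  simp

lemma factorialAlternant_zero_staircase_ne_zero [IsDomain R] {r : ℕ} {z : Fin r → R}
    (hz : Function.Injective z) : factorialAlternant z 0 (staircase r) ≠ 0 := by
  rw [factorialAlternant_zero_staircase]
  refine mul_ne_zero ?_ (Matrix.det_vandermonde_ne_zero_iff.2 hz)
  rcases Int.units_eq_one_or (Equiv.Perm.sign (Fin.revPerm (n := r))) with h | h <;> simp [h]

lemma factorialAlternant_eq_zero {r : ℕ} {z : Fin r → R} (hz : ¬ Function.Injective z)
    (b : ℕ → R) (k : Fin r → ℕ) : factorialAlternant z b k = 0 := by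
  simp only [Function.Injective, not_forall] at hz
  obtain ⟨i, j, h, hij⟩ := hz
  refine Matrix.det_zero_of_row_eq hij ?_
  ext l
  simp [h]

end Vandermonde

open MvPolynomial

variable {r : ℕ}

lemma alternant_eq_factorialAlternant (k : Fin r → ℕ) :
    alternant k = factorialAlternant (R := MvPolynomial (Fin r) ℂ) X 0 k := by
  rw [alternant, factorialAlternant]
  congr 1
  ext i j : 2
  simp

lemma alternant_eq_sum (k : Fin r → ℕ) :
    alternant k = ∑ σ : Equiv.Perm (Fin r), Equiv.Perm.sign σ •
      (monomial (Finsupp.equivFunOnFinite.symm fun i => k (σ⁻¹ i)) 1 : MvPolynomial (Fin r) ℂ) := by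
  rw [alternant, Matrix.det_apply]
  refine Finset.sum_congr rfl fun σ _ => ?_
  congr 1
  rw [monomial_eq, Finsupp.prod_fintype _ _ (by simp), C_1, one_mul,
    ← Equiv.prod_comp σ fun i => (X i : MvPolynomial (Fin r) ℂ) ^ _]
  simp

lemma sameTop_factorialAlternant (b : ℕ → ℂ) (k : Fin r → ℕ) :
    SameTop (∑ j, k j) (factorialAlternant (fun i => X i) (fun l => C (b l)) k)
      (alternant k) := by
  rw [alternant, factorialAlternant, Matrix.det_apply, Matrix.det_apply]
  refine SameTop.sum _ fun σ _ => SameTop.zsmul_unit _ (SameTop.prod _ fun j _ => ?_)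
  have := SameTop.prod (Finset.range (k j)) (d := fun _ => 1) (f := fun l => X (σ j) - C (b l))
    (g := fun _ => X (σ j)) fun l _ => by
      simpa [sub_eq_add_neg] using SameTop.X_add_C (σ j) (-b l)
  simpa using this

/-- The first index moved by `σ` must go to a later one, where `k` is smaller. -/
lemma toLex_perm_le {k : Fin r → ℕ} (hk : StrictAnti k) (σ : Equiv.Perm (Fin r)) :
    toLex (Finsupp.equivFunOnFinite.symm fun i => k (σ i)) ≤
      toLex (Finsupp.equivFunOnFinite.symm k) := by
  by_cases h : ∀ i, σ i = i
  · simp [h]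
  · push Not at h
    refine le_of_lt (Finsupp.Lex.lt_iff.2 ?_)
    obtain ⟨i, hi, hmin⟩ := WellFounded.has_min (wellFounded_lt (α := Fin r)) {i | σ i ≠ i} h
    have hfix : ∀ j < i, σ j = j := fun j hj => by
      by_contra h'; exact hmin j h' hj
    refine ⟨i, fun j hj => by simp [hfix j hj], ?_⟩
    have : i < σ i := by
      rcases lt_trichotomy i (σ i) with h | h | h
      · exact h
      · exact absurd h.symm hi
      · exact absurd (σ.injective (hfix _ h)) hi
    simpa using hk this

lemma coeff_alternant_self {k : Fin r → ℕ} (hk : StrictAnti k) :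
    coeff (Finsupp.equivFunOnFinite.symm k) (alternant k) = 1 := by
  classical
  rw [alternant_eq_sum, coeff_sum, Finset.sum_eq_single 1]
  · simp
  · intro σ _ hσ
    rw [Units.smul_def, coeff_smul, coeff_monomial, if_neg, smul_zero]
    intro h
    apply hσ
    have h' := Finsupp.equivFunOnFinite.symm.injective h
    ext i
    have := hk.injective (congrFun h' (σ i))
    have h2 : σ⁻¹ (σ i) = i := σ.symm_apply_apply i
    rw [h2] at this
    simp [← this]
  · simp

lemma degree_lex_alternant {k : Fin r → ℕ} (hk : StrictAnti k) :
    MonomialOrder.lex.degree (alternant k) = Finsupp.equivFunOnFinite.symm k := by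
  classical
  refine MonomialOrder.lex.toSyn.injective (le_antisymm ?_ ?_)
  · rw [MonomialOrder.degree_le_iff]
    intro c hc
    rw [alternant_eq_sum] at hc
    obtain ⟨σ, _, hσ⟩ := Finset.mem_biUnion.1 (support_sum hc)
    rw [Units.smul_def] at hσ
    have := support_monomial_subset (Finsupp.support_smul hσ)
    rw [Finset.mem_singleton] at this
    rw [this, MonomialOrder.lex_le_iff]
    exact toLex_perm_le hk σ⁻¹
  · refine MonomialOrder.le_degree ?_
    rw [mem_support_iff, coeff_alternant_self hk]
    exact one_ne_zero

lemma leadingCoeff_lex_alternant {k : Fin r → ℕ} (hk : StrictAnti k) :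
    MonomialOrder.lex.leadingCoeff (alternant k) = 1 := by
  rw [MonomialOrder.leadingCoeff, degree_lex_alternant hk, coeff_alternant_self hk]

lemma strictAnti_staircase : StrictAnti (staircase r) := fun i j h => by
  have : (i : ℕ) < j := h
  have := j.2
  simp only [staircase]
  omega

lemma strictAnti_add_staircase {lam : Fin r → ℕ} (h : Antitone lam) :
    StrictAnti (lam + staircase r) := h.add_strictAnti strictAnti_staircase

lemma alternant_ne_zero {k : Fin r → ℕ} (hk : StrictAnti k) : alternant k ≠ 0 := by
  intro h
  have := coeff_alternant_self hk
  simp [h] at this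

/-- Lexicographic leading terms are multiplicative, so `S` has leading exponent `(λ + δ) - δ` and
leading coefficient `1`. -/
lemma coeff_eq_one_of_mul_alternant {lam : Fin r → ℕ} (hlam : Antitone lam)
    {S : MvPolynomial (Fin r) ℂ}
    (hS : S * alternant (staircase r) = alternant (lam + staircase r)) :
    coeff (Finsupp.equivFunOnFinite.symm lam) S = 1 := by
  have hA := alternant_ne_zero (strictAnti_add_staircase hlam)
  have hV := alternant_ne_zero (strictAnti_staircase (r := r))
  have hS0 : S ≠ 0 := by rintro rfl; exact hA (by rw [← hS, zero_mul])
  have h1 := MonomialOrder.degree_mul (m := MonomialOrder.lex) hS0 hV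
  have h2 := MonomialOrder.leadingCoeff_mul (m := MonomialOrder.lex) (f := S)
    (g := alternant (staircase r))
  rw [hS, degree_lex_alternant (strictAnti_add_staircase hlam),
    degree_lex_alternant strictAnti_staircase] at h1
  rw [hS, leadingCoeff_lex_alternant (strictAnti_add_staircase hlam),
    leadingCoeff_lex_alternant strictAnti_staircase, mul_one] at h2
  have h3 : MonomialOrder.lex.degree S = Finsupp.equivFunOnFinite.symm lam := by
    ext i
    have := DFunLike.congr_fun h1 i
    simpa using this.symm
  rw [h2, MonomialOrder.leadingCoeff, h3]

lemma eval_aeval {σ τ : Type*} (z : τ → ℂ) (g : σ → MvPolynomial τ ℂ) (p : MvPolynomial σ ℂ) :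
    eval z (aeval g p) = eval (fun i => eval z (g i)) p := by
  simpa [coe_aeval_eq_eval] using comp_aeval_apply g (aeval z) p

/-! ### Schur polynomials and factorial Schur polynomials -/

lemma schurPolynomial_mul_alternant (lam : Fin r → ℕ) :
    schurPolynomial lam * alternant (staircase r) = alternant (lam + staircase r) := by
  have h : ∃! S : MvPolynomial (Fin r) ℂ, S * alternant (fun j : Fin r => r - 1 - (j : ℕ)) =
      alternant (fun j : Fin r => lam j + (r - 1 - (j : ℕ))) := by
    obtain ⟨S, hS⟩ := factorialAlternant_zero_staircase_dvd (R := MvPolynomial (Fin r) ℂ) X 0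
      (lam + staircase r)
    rw [← alternant_eq_factorialAlternant, ← alternant_eq_factorialAlternant] at hS
    refine ⟨S, (mul_comm _ _).trans hS.symm, fun S' hS' => ?_⟩
    refine mul_right_cancel₀ (alternant_ne_zero (strictAnti_staircase (r := r))) ?_
    rw [mul_comm S, ← hS]
    exact hS'
  rw [schurPolynomial, dif_pos h]
  exact h.choose_spec.1

/-- Keeping the shifts as indeterminates makes the quotient polynomial, hence continuous, in
variables and shifts jointly. The limits in `q` and in `β` rest on this. -/
lemma exists_universalFactorialSchur (lam : Fin r → ℕ) :
    ∃ S : MvPolynomial (Fin r ⊕ ℕ) ℂ,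
      S * factorialAlternant (fun i => X (Sum.inl i)) 0 (staircase r) =
        factorialAlternant (fun i => X (Sum.inl i)) (fun l => X (Sum.inr l))
          (lam + staircase r) := by
  obtain ⟨S, hS⟩ := factorialAlternant_zero_staircase_dvd (R := MvPolynomial (Fin r ⊕ ℕ) ℂ)
    (fun i => X (Sum.inl i)) (fun l => X (Sum.inr l)) (lam + staircase r)
  exact ⟨S, by rw [hS, mul_comm]⟩

/-- The factorial Schur polynomial with indeterminate variables and shift parameters. -/
def universalFactorialSchur (lam : Fin r → ℕ) : MvPolynomial (Fin r ⊕ ℕ) ℂ :=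
  (exists_universalFactorialSchur lam).choose

/-- The factorial Schur polynomial `s_λ(x | b)`, the quotient of
`det ((x_i - b_0) ⋯ (x_i - b_{λ_j + r - j - 1}))` by the Vandermonde determinant. -/
def factorialSchur (lam : Fin r → ℕ) (b : ℕ → ℂ) : MvPolynomial (Fin r) ℂ :=
  aeval (Sum.elim X fun l => C (b l)) (universalFactorialSchur lam)

lemma eval_factorialSchur (lam : Fin r → ℕ) (b : ℕ → ℂ) (z : Fin r → ℂ) :
    eval z (factorialSchur lam b) = eval (Sum.elim z b) (universalFactorialSchur lam) := by
  rw [factorialSchur, eval_aeval]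
  congr 2
  ext i
  rcases i with i | l <;> simp

lemma factorialSchur_mul_alternant (lam : Fin r → ℕ) (b : ℕ → ℂ) :
    factorialSchur lam b * alternant (staircase r) =
      factorialAlternant (fun i => X i) (fun l => C (b l)) (lam + staircase r) := by
  have h := congrArg (aeval (R := ℂ) (Sum.elim (X : Fin r → MvPolynomial (Fin r) ℂ)
    fun l => C (b l))) (exists_universalFactorialSchur lam).choose_spec
  rw [map_mul, ← AlgHom.coe_toRingHom, map_factorialAlternant, map_factorialAlternant] at h
  simp only [AlgHom.coe_toRingHom, aeval_X, Sum.elim_inl, Sum.elim_inr, Pi.zero_apply,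
    map_zero] at h
  rw [alternant_eq_factorialAlternant]
  exact h

lemma eval_factorialSchur_mul (lam : Fin r → ℕ) (b : ℕ → ℂ) (z : Fin r → ℂ) :
    eval z (factorialSchur lam b) * factorialAlternant z 0 (staircase r) =
      factorialAlternant z b (lam + staircase r) := by
  have h := congrArg (eval z) (factorialSchur_mul_alternant lam b)
  rw [map_mul, alternant_eq_factorialAlternant, map_factorialAlternant,
    map_factorialAlternant] at h
  simp only [eval_X, Pi.zero_apply, map_zero, eval_C] at h
  exact h

lemma sum_add_staircase (lam : Fin r → ℕ) :
    ∑ j, (lam + staircase r) j = ∑ j, lam j + ∑ j, staircase r j := by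
  simp [Finset.sum_add_distrib]

lemma sameTop_of_mul_alternant {N : ℕ} {p h : MvPolynomial (Fin r) ℂ}
    (H : SameTop (N + ∑ j, staircase r j) (p * alternant (staircase r))
      (h * alternant (staircase r))) : SameTop N p h := by
  have hc : coeff (Finsupp.equivFunOnFinite.symm (staircase r)) (alternant (staircase r)) ≠ 0 := by
    rw [coeff_alternant_self strictAnti_staircase]; exact one_ne_zero
  refine ⟨mem_degreeLT_of_mul_mem _ hc (Finsupp.degree_eq_sum _) ?_,
    mem_degreeLT_of_mul_mem _ hc (Finsupp.degree_eq_sum _) ?_⟩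
  · have := H.mem
    rwa [add_right_comm] at this
  · rw [sub_mul]
    exact H.sub_mem

lemma sameTop_factorialSchur (lam : Fin r → ℕ) (b : ℕ → ℂ) :
    SameTop (∑ i, lam i) (factorialSchur lam b) (schurPolynomial lam) := by
  refine sameTop_of_mul_alternant ?_
  rw [factorialSchur_mul_alternant, schurPolynomial_mul_alternant, ← sum_add_staircase]
  exact sameTop_factorialAlternant _ _

/-- The difference from the Schur polynomial has degree below `|λ|`, so it does not reach `x^λ`. -/
lemma coeff_factorialSchur {lam : Fin r → ℕ} (hlam : Antitone lam) (b : ℕ → ℂ) :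
    coeff (Finsupp.equivFunOnFinite.symm lam) (factorialSchur lam b) = 1 := by
  rw [← coeff_eq_one_of_mul_alternant hlam (schurPolynomial_mul_alternant lam), ← sub_eq_zero,
    ← coeff_sub]
  by_contra h
  have := mem_degreeLT.1 (sameTop_factorialSchur lam b).sub_mem _ (mem_support_iff.2 h)
  rw [Finsupp.degree_eq_sum] at this
  simp at this

/-- Numerator and denominator pick up the same sign. -/
lemma rename_factorialSchur (lam : Fin r → ℕ) (b : ℕ → ℂ) (w : Equiv.Perm (Fin r)) :
    rename w (factorialSchur lam b) = factorialSchur lam b := by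
  have hV := alternant_ne_zero (strictAnti_staircase (r := r))
  have key : ∀ (b : ℕ → ℂ) (k : Fin r → ℕ),
      rename w (factorialAlternant (fun i => X i) (fun l => C (b l)) k) =
      ((Equiv.Perm.sign w : ℤ) : MvPolynomial (Fin r) ℂ) *
        factorialAlternant (fun i => X i) (fun l => C (b l)) k := fun b k => by
    rw [← factorialAlternant_perm, ← AlgHom.coe_toRingHom, map_factorialAlternant]
    simp
  have key0 := key 0 (staircase r)
  have e : (fun l => C ((0 : ℕ → ℂ) l) : ℕ → MvPolynomial (Fin r) ℂ) = 0 := by ext; simp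
  rw [e] at key0
  have h := congrArg (rename w) (factorialSchur_mul_alternant lam b)
  rw [alternant_eq_factorialAlternant] at hV
  rw [map_mul, key, ← factorialSchur_mul_alternant, alternant_eq_factorialAlternant,
    key0, mul_left_comm] at h
  refine mul_right_cancel₀ hV (mul_left_cancel₀ ?_ h)
  rcases Int.units_eq_one_or (Equiv.Perm.sign w) with h | h <;> simp [h]

/-- The numerator scales by `u^(|λ| + |δ|)` and the Vandermonde determinant by `u^|δ|`. -/
lemma aeval_affine_factorialSchur (lam : Fin r → ℕ) (b : ℕ → ℂ) {u : ℂ} (hu : u ≠ 0) (v : ℂ) :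
    aeval (fun i => C u * X i + C v : Fin r → MvPolynomial (Fin r) ℂ)
        (factorialSchur lam fun l => u * b l + v) =
      C (u ^ ∑ i, lam i) * factorialSchur lam b := by
  have hV := alternant_ne_zero (strictAnti_staircase (r := r))
  have h := congrArg (aeval (R := ℂ) (fun i => C u * X i + C v : Fin r → MvPolynomial (Fin r) ℂ))
    (factorialSchur_mul_alternant lam fun l => u * b l + v)
  rw [map_mul, alternant_eq_factorialAlternant, ← AlgHom.coe_toRingHom, map_factorialAlternant,
    map_factorialAlternant] at h
  simp only [AlgHom.coe_toRingHom, aeval_X, Pi.zero_apply, map_zero, aeval_C, algebraMap_eq] at h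
  have e : (fun l => C (u * b l + v) : ℕ → MvPolynomial (Fin r) ℂ) =
      fun l => C u * C (b l) + C v := by ext1 l; simp
  have e' : (fun _ => 0 : ℕ → MvPolynomial (Fin r) ℂ) = 0 := rfl
  rw [e, e', factorialAlternant_affine, factorialAlternant_zero_staircase_affine,
    ← factorialSchur_mul_alternant, sum_add_staircase] at h
  have hC : (C u : MvPolynomial (Fin r) ℂ) ^ (∑ j, staircase r j) ≠ 0 :=
    pow_ne_zero _ (by simpa using hu)
  refine mul_right_cancel₀ hV (mul_left_cancel₀ hC ?_)
  rw [mul_left_comm]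
  refine Eq.trans ?_ (h.trans ?_)
  · rw [alternant_eq_factorialAlternant]
  · rw [pow_add, C_pow]; ring

lemma eval_affine_factorialSchur (lam : Fin r → ℕ) (b : ℕ → ℂ) {u : ℂ} (hu : u ≠ 0) (v : ℂ)
    (z : Fin r → ℂ) :
    eval (fun i => u * z i + v) (factorialSchur lam fun l => u * b l + v) =
      u ^ (∑ i, lam i) * eval z (factorialSchur lam b) := by
  have h := congrArg (eval z) (aeval_affine_factorialSchur lam b hu v)
  rw [map_mul, eval_C] at h
  rw [← h, eval_aeval]
  simp

end Alternants

/-! ### Okounkov's Laurent polynomials at `t = q` -/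

section LaurentPolynomials

open MvPolynomial

variable {r : ℕ}

/-! ### Laurent polynomials in `x_i + x_i⁻¹` -/

/-- The Laurent polynomial `x_i + x_i⁻¹`. -/
def symVar (i : Fin r) : AddMonoidAlgebra ℂ (Fin r → ℤ) :=
  AddMonoidAlgebra.single (Pi.single i 1) 1 + AddMonoidAlgebra.single (-Pi.single i 1) 1

/-- The substitution `X_i ↦ x_i + x_i⁻¹`. -/
def toLaurent : MvPolynomial (Fin r) ℂ →ₐ[ℂ] AddMonoidAlgebra ℂ (Fin r → ℤ) :=
  aeval symVar

lemma coeff_symVar_mul (i : Fin r) (f : AddMonoidAlgebra ℂ (Fin r → ℤ)) (k : Fin r → ℤ) :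
    (symVar i * f).coeff k = f.coeff (k - Pi.single i 1) + f.coeff (k + Pi.single i 1) := by
  rw [symVar, add_mul, AddMonoidAlgebra.coeff_add, Finsupp.add_apply,
    AddMonoidAlgebra.coeff_single_mul_apply, AddMonoidAlgebra.coeff_single_mul_apply, one_mul,
    one_mul, neg_neg, neg_add_eq_sub, add_comm k]

lemma sum_add_single (k : Fin r → ℤ) (i : Fin r) (c : ℤ) :
    ∑ j, (k + Pi.single i c : Fin r → ℤ) j = ∑ j, k j + c := by
  simp [Finset.sum_add_distrib]

/-- In the expansion of `∏ (x_i + x_i⁻¹)^(m_i)`, each choice of an inverse lowers the exponent sum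
by two, so only `x^m` reaches the sum `|m|`. -/
lemma coeff_toLaurent_monomial (m : Fin r →₀ ℕ) (k : Fin r → ℤ)
    (hk : (m.degree : ℤ) ≤ ∑ i, k i) :
    (toLaurent (monomial m 1)).coeff k = if k = fun i => (m i : ℤ) then 1 else 0 := by
  obtain ⟨s, rfl⟩ := Multiset.toFinsupp.surjective m
  induction s using Multiset.induction_on generalizing k with
  | empty =>
    have : (monomial (0 : Fin r →₀ ℕ) (1 : ℂ)) = 1 := rfl
    rw [map_zero, this, map_one, AddMonoidAlgebra.one_def, AddMonoidAlgebra.coeff_single,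
      Finsupp.single_apply]
    simp [eq_comm, funext_iff]
  | cons a s ih =>
    rw [← Multiset.singleton_add, map_add, Multiset.toFinsupp_singleton] at hk ⊢
    have e : monomial (Finsupp.single a 1 + Multiset.toFinsupp s) (1 : ℂ) =
        X a * monomial (Multiset.toFinsupp s) 1 := by
      rw [X, monomial_mul, one_mul]
    have ea : toLaurent (X a : MvPolynomial (Fin r) ℂ) = symVar a := aeval_X _ _
    have h1 : ∑ i, (k - Pi.single a 1 : Fin r → ℤ) i = ∑ i, k i - 1 := by
      simp [Finset.sum_sub_distrib]
    have h2 := sum_add_single k a 1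
    have hdeg : ((Finsupp.single a 1 + Multiset.toFinsupp s).degree : ℤ) =
        1 + (Multiset.toFinsupp s).degree := by simp
    rw [hdeg] at hk
    rw [e, map_mul, ea, coeff_symVar_mul, ih _ (by rw [h1]; omega), ih _ (by rw [h2]; omega)]
    have hne : k + Pi.single a 1 ≠ fun i => ((Multiset.toFinsupp s) i : ℤ) := by
      intro h
      rw [h] at h2
      rw [Finsupp.degree_eq_sum] at hk
      push_cast at hk
      simp only at h2
      omega
    rw [if_neg hne, add_zero]
    congr 1
    rw [sub_eq_iff_eq_add, eq_iff_iff]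
    refine ⟨?_, ?_⟩
    · rintro rfl
      ext i
      rcases eq_or_ne i a with rfl | h <;> simp [*, add_comm]
    · rintro rfl
      ext i
      rcases eq_or_ne i a with rfl | h <;> simp [*, add_comm]

lemma coeff_toLaurent {N : ℕ} {p : MvPolynomial (Fin r) ℂ} (hp : p ∈ degreeLT r (N + 1))
    (k : Fin r → ℤ) (hk : (N : ℤ) ≤ ∑ i, k i) :
    (toLaurent p).coeff k =
      ∑ m ∈ p.support, if k = fun i => (m i : ℤ) then coeff m p else 0 := by
  conv_lhs => rw [p.as_sum, map_sum, AddMonoidAlgebra.coeff_sum, Finsupp.finsetSum_apply]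
  refine Finset.sum_congr rfl fun m hm => ?_
  have hm' : (m.degree : ℤ) ≤ ∑ i, k i :=
    (Nat.cast_le.2 (Nat.lt_succ_iff.1 (mem_degreeLT.1 hp m hm))).trans hk
  have e : monomial m (coeff m p) = coeff m p • monomial m 1 := by simp [smul_monomial]
  rw [e, map_smul, AddMonoidAlgebra.coeff_smul, Finsupp.smul_apply,
    coeff_toLaurent_monomial m k hm']
  simp

lemma sum_le_of_mem_support_toLaurent {N : ℕ} {p : MvPolynomial (Fin r) ℂ}
    (hp : p ∈ degreeLT r (N + 1)) {k : Fin r → ℤ} (hk : k ∈ (toLaurent p).coeff.support) :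
    ∑ i, k i ≤ N := by
  by_contra! h
  rw [Finsupp.mem_support_iff, coeff_toLaurent hp k h.le] at hk
  obtain ⟨m, hm, hne⟩ := Finset.exists_ne_zero_of_sum_ne_zero hk
  have := mem_degreeLT.1 hp m hm
  rw [Finsupp.degree_eq_sum] at this
  rw [ne_eq, ite_eq_right_iff, Classical.not_imp] at hne
  rw [hne.1] at h
  simp only at h
  have h' : N < ∑ i, m i := by exact_mod_cast h
  omega

lemma coeff_toLaurent_top {N : ℕ} {p : MvPolynomial (Fin r) ℂ} (hp : p ∈ degreeLT r (N + 1))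
    (m : Fin r →₀ ℕ) (hm : m.degree = N) :
    (toLaurent p).coeff (fun i => (m i : ℤ)) = coeff m p := by
  rw [coeff_toLaurent hp]
  · have : ∀ m' : Fin r →₀ ℕ, ((fun i => (m i : ℤ)) = fun i => (m' i : ℤ)) ↔ m = m' :=
      fun m' => by simp [funext_iff, Finsupp.ext_iff]
    simp only [this, Finset.sum_ite_eq, mem_support_iff]
    simp +contextual [eq_comm]
  · rw [← hm, Finsupp.degree_eq_sum]
    push_cast
    exact le_rfl

/-- Evaluation of Laurent polynomials at a point of the torus. -/
def laurentEvalHom (x : Fin r → ℂ) (hx : ∀ i, x i ≠ 0) :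
    AddMonoidAlgebra ℂ (Fin r → ℤ) →ₐ[ℂ] ℂ :=
  AddMonoidAlgebra.lift ℂ ℂ (Fin r → ℤ)
    { toFun := fun m => ∏ i, x i ^ m.toAdd i
      map_one' := by simp
      map_mul' := fun m m' => by
        simp [zpow_add₀ (hx _), Finset.prod_mul_distrib] }

lemma laurentEvalHom_apply (x : Fin r → ℂ) (hx : ∀ i, x i ≠ 0)
    (P : AddMonoidAlgebra ℂ (Fin r → ℤ)) : laurentEvalHom x hx P = laurentEval P x := by
  rw [laurentEvalHom, AddMonoidAlgebra.lift_apply]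
  rfl

lemma laurentEval_toLaurent (p : MvPolynomial (Fin r) ℂ) {x : Fin r → ℂ} (hx : ∀ i, x i ≠ 0) :
    laurentEval (toLaurent p) x = eval (fun i => x i + (x i)⁻¹) p := by
  rw [← laurentEvalHom_apply x hx, toLaurent, comp_aeval_apply, ← coe_aeval_eq_eval,
    RingHom.coe_coe]
  congr 2
  ext i
  have h : ∀ c : ℤ, ∏ j, x j ^ (Pi.single i c : Fin r → ℤ) j = x i ^ c := fun c => by
    rw [Fintype.prod_eq_single i fun j hj => by simp [hj], Pi.single_eq_same]
  rw [symVar, map_add, laurentEvalHom, AddMonoidAlgebra.lift_single,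
    AddMonoidAlgebra.lift_single, ← Pi.single_neg]
  simp only [MonoidHom.coe_mk, OneHom.coe_mk, toAdd_ofAdd, h]
  simp

/-! ### Symmetries -/

/-- Permutation of the coordinates of the exponents. -/
def permExponents (w : Equiv.Perm (Fin r)) : (Fin r → ℤ) ≃+ (Fin r → ℤ) where
  toFun m i := m (w i)
  invFun m i := m (w.symm i)
  left_inv m := by simp
  right_inv m := by simp
  map_add' _ _ := rfl

/-- Sign changes of the coordinates of the exponents. -/
def signExponents (e : Fin r → ℤˣ) : (Fin r → ℤ) ≃+ (Fin r → ℤ) where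
  toFun m i := (e i : ℤ) * m i
  invFun m i := (e i : ℤ) * m i
  left_inv m := by ext i; simp [← mul_assoc]
  right_inv m := by ext i; simp [← mul_assoc]
  map_add' _ _ := by ext i; simp [mul_add]

lemma domCongr_signExponents_toLaurent (e : Fin r → ℤˣ) (p : MvPolynomial (Fin r) ℂ) :
    AddMonoidAlgebra.domCongr ℂ ℂ (signExponents e) (toLaurent p) = toLaurent p := by
  rw [toLaurent, ← AlgEquiv.coe_toAlgHom, comp_aeval_apply]
  congr 2
  ext1 i
  rw [AlgEquiv.coe_toAlgHom]
  have h : signExponents e (Pi.single i 1) = Pi.single i (e i : ℤ) := by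
    ext j
    rcases eq_or_ne j i with rfl | h <;> simp [signExponents, *]
  rw [symVar, map_add, AddMonoidAlgebra.domCongr_single, AddMonoidAlgebra.domCongr_single,
    map_neg, h]
  rcases Int.units_eq_one_or (e i) with h | h
  · simp [h]
  · simp [h, Pi.single_neg, add_comm]

lemma domCongr_permExponents_toLaurent (w : Equiv.Perm (Fin r)) (p : MvPolynomial (Fin r) ℂ) :
    AddMonoidAlgebra.domCongr ℂ ℂ (permExponents w) (toLaurent p) =
      toLaurent (rename w.symm p) := by
  rw [toLaurent, ← AlgEquiv.coe_toAlgHom, comp_aeval_apply, aeval_rename]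
  congr 2
  ext1 i
  rw [AlgEquiv.coe_toAlgHom]
  have h : permExponents w (Pi.single i 1) = Pi.single (w.symm i) 1 := by
    ext j
    rcases eq_or_ne j (w.symm i) with rfl | h
    · simp [permExponents]
    · have : w j ≠ i := fun h' => h (by simp [← h'])
      simp [permExponents, *]
  simp only [symVar, map_add, AddMonoidAlgebra.domCongr_single, AddMonoidAlgebra.domCongr_single,
    map_neg, h, Function.comp]

lemma coeff_signExponents_toLaurent (e : Fin r → ℤˣ) (p : MvPolynomial (Fin r) ℂ)
    (m : Fin r → ℤ) :
    (toLaurent p).coeff (fun i => (e i : ℤ) * m i) = (toLaurent p).coeff m := by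
  conv_rhs => rw [← domCongr_signExponents_toLaurent e, AddMonoidAlgebra.coeff_domCongr]
  rfl

lemma coeff_permExponents_toLaurent (w : Equiv.Perm (Fin r)) {p : MvPolynomial (Fin r) ℂ}
    (hp : rename w p = p) (m : Fin r → ℤ) :
    (toLaurent p).coeff (fun i => m (w i)) = (toLaurent p).coeff m := by
  have h := domCongr_permExponents_toLaurent w.symm p
  rw [w.symm_symm, hp] at h
  conv_rhs => rw [← h, AddMonoidAlgebra.coeff_domCongr]
  rfl

lemma laurentEval_perm {P : AddMonoidAlgebra ℂ (Fin r → ℤ)}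
    (hP : ∀ (w : Equiv.Perm (Fin r)) (m : Fin r → ℤ), P.coeff (fun i => m (w i)) = P.coeff m)
    (w : Equiv.Perm (Fin r)) (x : Fin r → ℂ) :
    laurentEval P (fun i => x (w i)) = laurentEval P x := by
  rw [laurentEval, laurentEval, Finsupp.sum, Finsupp.sum]
  refine Finset.sum_equiv (permExponents w.symm).toEquiv (fun m => ?_) fun m _ => ?_
  · rw [Finsupp.mem_support_iff, Finsupp.mem_support_iff]
    exact not_congr (by rw [← hP w.symm m]; rfl)
  · have h1 : P.coeff m = P.coeff ((permExponents w.symm).toEquiv m) := (hP w.symm m).symm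
    rw [← h1, ← Equiv.prod_comp w fun i => x i ^ (permExponents w.symm).toEquiv m i]
    congr 1
    refine Finset.prod_congr rfl fun i _ => ?_
    simp [permExponents]

/-! ### Invariant Laurent polynomials are polynomials in `x_i + x_i⁻¹` -/

/-- Chebyshev recursion: `x^(k+2) + x^(-k-2) = (x + x⁻¹)(x^(k+1) + x^(-k-1)) - (x^k + x^(-k))`. For
`k = 0` the two monomials coincide, whence the constant `2`. -/
lemma exists_toLaurent_eq_single_add (i : Fin r) (k : ℕ) :
    ∃ p ∈ degreeLT r (k + 1), toLaurent p =
      AddMonoidAlgebra.single (Pi.single i (k : ℤ)) 1 +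
        AddMonoidAlgebra.single (Pi.single i (-k : ℤ)) 1 := by
  induction k using Nat.twoStepInduction with
  | zero =>
    refine ⟨C 2, C_mem_degreeLT _, ?_⟩
    have : (C 2 : MvPolynomial (Fin r) ℂ) = 1 + 1 := by rw [← C_1, ← C_add]; norm_num
    rw [this, map_add, map_one]
    simp [AddMonoidAlgebra.one_def]
  | one => exact ⟨X i, X_mem_degreeLT i, by simp [toLaurent, symVar, Pi.single_neg]⟩
  | more k ih ih' =>
    obtain ⟨p, hp, h⟩ := ih
    obtain ⟨p', hp', h'⟩ := ih'
    refine ⟨X i * p' - p, Submodule.sub_mem _ ?_ (degreeLT_mono (by omega) hp), ?_⟩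
    · have := mul_mem_degreeLT (X_mem_degreeLT i) hp'
      exact degreeLT_mono (by omega) this
    · have hX : toLaurent (X i) = symVar i := aeval_X _ _
      rw [map_sub, map_mul, hX, h, h', symVar, ← Pi.single_neg]
      simp only [add_mul, mul_add, AddMonoidAlgebra.single_mul_single, ← Pi.single_add, one_mul]
      have e1 : (1 + ((k + 1 : ℕ) : ℤ)) = ((k + 2 : ℕ) : ℤ) := by push_cast; ring
      have e2 : (1 + (-((k + 1 : ℕ) : ℤ))) = -(k : ℤ) := by push_cast; ring
      have e3 : (-1 + ((k + 1 : ℕ) : ℤ)) = (k : ℤ) := by push_cast; ring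
      have e4 : (-1 + (-((k + 1 : ℕ) : ℤ))) = -((k + 2 : ℕ) : ℤ) := by push_cast; ring
      rw [e1, e2, e3, e4]
      abel

lemma prod_single_single (m : Fin r → ℤ) :
    ∏ i, AddMonoidAlgebra.single (Pi.single i (m i) : Fin r → ℤ) (1 : ℂ) =
      AddMonoidAlgebra.single m 1 := by
  have h := map_prod (AddMonoidAlgebra.of ℂ (Fin r → ℤ))
    (fun i => Multiplicative.ofAdd (Pi.single i (m i) : Fin r → ℤ)) Finset.univ
  simp only [AddMonoidAlgebra.of_apply, toAdd_ofAdd] at h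
  rw [← h, toAdd_prod]
  simp [Finset.univ_sum_single]

/-- The product of the one-variable sums. Summing over the whole sign group rather than over the
orbit keeps this uniform when some `m_i = 0`. -/
lemma exists_toLaurent_eq_sum_single (m : Fin r → ℤ) :
    ∃ p ∈ degreeLT r (∑ i, (m i).natAbs + 1), toLaurent p =
      ∑ e : Fin r → ℤˣ, AddMonoidAlgebra.single (signExponents e m) 1 := by
  choose p hp h using fun i => exists_toLaurent_eq_single_add i (m i).natAbs
  refine ⟨∏ i, p i, (SameTop.prod _ fun i _ => SameTop.refl (hp i)).mem, ?_⟩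
  have h' : ∀ i, toLaurent (p i) = ∑ u : ℤˣ,
      AddMonoidAlgebra.single (Pi.single i ((u : ℤ) * m i)) 1 := fun i => by
    rw [h i]
    have : (Finset.univ : Finset ℤˣ) = {1, -1} := rfl
    rw [this, Finset.sum_pair (by decide)]
    rcases Int.natAbs_eq (m i) with e | e <;> rw [e] <;> simp [add_comm]
  rw [map_prod, Finset.prod_congr rfl fun i _ => h' i, Finset.prod_univ_sum,
    Fintype.piFinset_univ]
  refine Finset.sum_congr rfl fun e _ => ?_
  exact prod_single_single fun i => (e i : ℤ) * m i

/-- A Laurent polynomial that is invariant under inversions of the variables is a polynomial in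
the `x_i + x_i⁻¹`. -/
lemma exists_toLaurent_eq {N : ℕ} {P : AddMonoidAlgebra ℂ (Fin r → ℤ)}
    (hdeg : ∀ m ∈ P.coeff.support, ∑ i, m i ≤ N)
    (hinv : ∀ (e : Fin r → ℤˣ) (m : Fin r → ℤ),
      P.coeff (fun i => (e i : ℤ) * m i) = P.coeff m) :
    ∃ p ∈ degreeLT r (N + 1), toLaurent p = P := by
  choose p hp h using exists_toLaurent_eq_sum_single (r := r)
  -- The hypothesis bounds signed sums only; by invariance, the exponent with all signs made
  -- nonnegative also occurs, which bounds `∑ |m_i|`.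
  have hdeg' : ∀ m ∈ P.coeff.support, ∑ i, (m i).natAbs ≤ N := fun m hm => by
    have hm' : (fun i => ((if 0 ≤ m i then 1 else -1 : ℤˣ) : ℤ) * m i) ∈ P.coeff.support := by
      rw [Finsupp.mem_support_iff] at hm ⊢
      rwa [hinv]
    have := hdeg _ hm'
    have e : ∀ i, ((if 0 ≤ m i then 1 else -1 : ℤˣ) : ℤ) * m i = (m i).natAbs := fun i => by
      split_ifs with h0
      · simp [abs_of_nonneg h0]
      · simp [abs_of_neg (not_le.1 h0)]
    simp only [e] at this
    exact_mod_cast this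
  have hP : P = ∑ m ∈ P.coeff.support, P.coeff m • AddMonoidAlgebra.single m 1 := by
    ext m
    rw [AddMonoidAlgebra.coeff_sum, Finsupp.finsetSum_apply]
    simp [Finsupp.single_apply, Finset.sum_ite_eq']
  have hPe : ∀ e : Fin r → ℤˣ, AddMonoidAlgebra.domCongr ℂ ℂ (signExponents e) P = P :=
    fun e => by
      ext m
      rw [AddMonoidAlgebra.coeff_domCongr]
      exact hinv e m
  -- Averaging over the `2^r` sign changes, each of which fixes `P`.
  have hsum : ∑ m ∈ P.coeff.support, P.coeff m • toLaurent (p m) = (2 : ℂ) ^ r • P := by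
    have h2 : ∑ e : Fin r → ℤˣ, AddMonoidAlgebra.domCongr ℂ ℂ (signExponents e) P =
        (2 : ℂ) ^ r • P := by
      rw [Finset.sum_congr rfl fun e _ => hPe e, Finset.sum_const, Finset.card_univ,
        Fintype.card_fun, ← Nat.cast_smul_eq_nsmul ℂ]
      simp
    rw [← h2]
    conv_rhs =>
      enter [2, e]
      rw [hP, map_sum]
    rw [Finset.sum_comm]
    refine Finset.sum_congr rfl fun m _ => ?_
    rw [h, Finset.smul_sum]
    refine Finset.sum_congr rfl fun e _ => ?_
    rw [map_smul, AddMonoidAlgebra.domCongr_single]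
  refine ⟨((2 : ℂ) ^ r)⁻¹ • ∑ m ∈ P.coeff.support, P.coeff m • p m, ?_, ?_⟩
  · refine Submodule.smul_mem _ _ (Submodule.sum_mem _ fun m hm => Submodule.smul_mem _ _ ?_)
    exact degreeLT_mono (Nat.succ_le_succ (hdeg' m hm)) (hp m)
  · rw [map_smul, map_sum]
    simp only [map_smul]
    rw [hsum, smul_smul, inv_mul_cancel₀ (pow_ne_zero _ two_ne_zero), one_smul]

/-! ### Interpolation -/

/-- A polynomial of degree at most `N` that vanishes at the points `(η_{m_1}, …, η_{m_r})` with
`m_1 + ⋯ + m_r ≤ N` is zero. -/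
lemma eq_zero_of_eval_nodes {N : ℕ} {η : ℕ → ℂ} (hη : Function.Injective η)
    {p : MvPolynomial (Fin r) ℂ} (hp : p ∈ degreeLT r (N + 1))
    (h : ∀ m : Fin r → ℕ, ∑ i, m i ≤ N → eval (fun i => η (m i)) p = 0) : p = 0 := by
  by_contra hp0
  obtain ⟨t, ht, hmax⟩ := Finset.exists_max_image p.support Finsupp.degree
    (support_nonempty.2 hp0)
  have hdeg : p.totalDegree = t.degree := by
    refine le_antisymm (totalDegree_le_of_mem_degreeLT (mem_degreeLT.2 fun m hm =>
      Nat.lt_succ_iff.2 (hmax m hm))) ?_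
    have := le_totalDegree ht
    rwa [Finsupp.sum_fintype _ _ (by simp), ← Finsupp.degree_eq_sum] at this
  -- Combinatorial Nullstellensatz for a monomial `t` of maximal degree, on the grid with sides
  -- `{η_0, …, η_{t_i}}`.
  obtain ⟨s, hs, hne⟩ := combinatorial_nullstellensatz_exists_eval_nonzero p t
    (mem_support_iff.1 ht) hdeg (fun i => (Finset.range (t i + 1)).image η) fun i => by
      rw [Finset.card_image_of_injective _ hη]; simp
  have hs' : ∀ i, ∃ k, k ≤ t i ∧ η k = s i := fun i => by
    simpa [Nat.lt_succ_iff] using hs i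
  choose m hm hms using hs'
  apply hne
  have : s = fun i => η (m i) := by ext i; rw [hms]
  rw [this]
  refine h m ((Finset.sum_le_sum fun i _ => hm i).trans ?_)
  have := mem_degreeLT.1 hp t ht
  rw [Finsupp.degree_eq_sum] at this
  omega

/-- If `λ_i > μ_i` at `i = i₀`, every entry in a row `≥ i₀` and a column `≤ i₀` contains a zero
factor. This block has `r - i₀` rows and `i₀ + 1` columns, so every permutation meets it. -/
lemma factorialAlternant_nodes_eq_zero {lam mu : Fin r → ℕ} (hlam : Antitone lam)
    (hmu : Antitone mu) (h : ¬ ∀ i, lam i ≤ mu i) (η : ℕ → ℂ) :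
    factorialAlternant (fun i => η (mu i + staircase r i)) η (lam + staircase r) = 0 := by
  push Not at h
  obtain ⟨i₀, hi₀⟩ := h
  rw [factorialAlternant, Matrix.det_apply]
  refine Finset.sum_eq_zero fun σ _ => ?_
  obtain ⟨j, hj, hσj⟩ : ∃ j ≤ i₀, i₀ ≤ σ j := by
    by_contra! hc
    have := Finset.card_le_card_of_injOn (s := Finset.Iic i₀) (t := Finset.Iio i₀) σ
      (fun j hj => Finset.mem_coe.2 (Finset.mem_Iio.2 (hc j (Finset.mem_Iic.1 hj)))) σ.injective.injOn
    simp at this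
  rw [Finset.prod_eq_zero (Finset.mem_univ j), smul_zero]
  rw [Matrix.of_apply]
  refine Finset.prod_eq_zero (i := mu (σ j) + staircase r (σ j)) ?_ (sub_self _)
  have h1 := hmu hσj
  have h2 := hlam hj
  have h3 := strictAnti_staircase.antitone hσj
  have h4 := strictAnti_staircase.antitone hj
  rw [Finset.mem_range, Pi.add_apply]
  omega

lemma eval_factorialSchur_nodes {lam mu : Fin r → ℕ} (hlam : Antitone lam)
    (hmu : Antitone mu) (h : ¬ ∀ i, lam i ≤ mu i) {η : ℕ → ℂ} (hη : Function.Injective η) :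
    eval (fun i => η (mu i + staircase r i)) (factorialSchur lam η) = 0 := by
  have h1 := eval_factorialSchur_mul lam η (fun i => η (mu i + staircase r i))
  rw [factorialAlternant_nodes_eq_zero hlam hmu h] at h1
  refine (mul_eq_zero.1 h1).resolve_right
    (factorialAlternant_zero_staircase_ne_zero fun i j hij => ?_)
  have hm : StrictAnti (mu + staircase r) := strictAnti_add_staircase hmu
  exact hm.injective (hη hij)

lemma exists_perm_eq_add_staircase {m : Fin r → ℕ} (hm : Function.Injective m) :
    ∃ (w : Equiv.Perm (Fin r)) (mu : Fin r → ℕ), Antitone mu ∧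
      ∀ i, m (w i) = mu i + staircase r i := by
  let w : Equiv.Perm (Fin r) := Fin.revPerm.trans (Tuple.sort m)
  have hw : StrictAnti fun i => m (w i) := by
    have h1 : StrictMono (m ∘ Tuple.sort m) :=
      (Tuple.monotone_sort m).strictMono_of_injective (hm.comp (Tuple.sort m).injective)
    exact fun i j hij => h1 (Fin.rev_lt_rev.2 hij)
  have hstep : ∀ i j : Fin r, i ≤ j → m (w j) + (j - i : ℕ) ≤ m (w i) := by
    intro i j hij
    obtain ⟨d, hd⟩ := Nat.exists_eq_add_of_le (show (i : ℕ) ≤ j from hij)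
    induction d generalizing j with
    | zero =>
      have : j = i := Fin.ext (by omega)
      subst this; simp
    | succ d ih =>
      have hlt : (i : ℕ) + d < r := by have := j.2; omega
      have h1 := ih ⟨i + d, hlt⟩ (Fin.le_def.2 (by simp)) rfl
      have h2 := hw (show (⟨i + d, hlt⟩ : Fin r) < j from Fin.lt_def.2 (by simp; omega))
      simp only at h1 h2
      omega
  have hlow : ∀ i, staircase r i ≤ m (w i) := fun i => by
    have hi := i.2
    have := hstep i ⟨r - 1, by omega⟩ (Fin.le_def.2 (by simp; omega))
    simp only [staircase] at this ⊢
    omega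
  refine ⟨w, fun i => m (w i) - staircase r i, fun i j hij => ?_, fun i => ?_⟩
  · have h1 := hstep i j hij
    have h2 := hlow i
    have h3 := hlow j
    have h4 : (i : ℕ) ≤ j := hij
    have h5 := j.2
    simp only [staircase] at h2 h3 ⊢
    omega
  · have := hlow i
    simp only
    omega

/-- A symmetric polynomial that satisfies the vanishing conditions is a multiple of the factorial
Schur polynomial. -/
lemma eq_C_mul_factorialSchur {lam : Fin r → ℕ} (hlam : Antitone lam) {η : ℕ → ℂ}
    (hη : Function.Injective η) {p : MvPolynomial (Fin r) ℂ}
    (hp : p ∈ degreeLT r (∑ i, lam i + 1))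
    (hsymm : ∀ (w : Equiv.Perm (Fin r)) (m : Fin r → ℕ),
      eval (fun i => η (m (w i))) p = eval (fun i => η (m i)) p)
    (hvan : ∀ mu : Fin r → ℕ, Antitone mu → ¬ (∀ i, lam i ≤ mu i) →
      eval (fun i => η (mu i + staircase r i)) p = 0) :
    ∃ c : ℂ, p = C c * factorialSchur lam η := by
  have hV := alternant_ne_zero (strictAnti_staircase (r := r))
  -- Uniqueness: if `p` also vanishes at the node of `λ`, then `p` times the Vandermonde determinant
  -- vanishes at all points `η_m` with `|m| ≤ |λ| + |δ|`. Repeated coordinates kill the determinant;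
  -- otherwise `m` is a permutation of some `μ + δ` with `|μ| ≤ |λ|`, and `λ ⊆ μ` then forces `μ =
  -- λ`.
  have key : ∀ p : MvPolynomial (Fin r) ℂ, p ∈ degreeLT r (∑ i, lam i + 1) →
      (∀ (w : Equiv.Perm (Fin r)) (m : Fin r → ℕ),
        eval (fun i => η (m (w i))) p = eval (fun i => η (m i)) p) →
      (∀ mu : Fin r → ℕ, Antitone mu → ¬ (∀ i, lam i ≤ mu i) →
        eval (fun i => η (mu i + staircase r i)) p = 0) →
      eval (fun i => η (lam i + staircase r i)) p = 0 → p = 0 := by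
    intro p hp hsymm hvan h0
    refine (mul_eq_zero.1 (eq_zero_of_eval_nodes (N := ∑ i, lam i + ∑ i, staircase r i) hη
      (p := p * alternant (staircase r)) ?_ fun m hm => ?_)).resolve_right hV
    · have hA : alternant (staircase r) ∈ degreeLT r (∑ i, staircase r i + 1) :=
        (sameTop_factorialAlternant 0 _).mem_right
      have := mul_mem_degreeLT hp hA
      rwa [add_right_comm] at this
    · rw [map_mul]
      by_cases hinj : Function.Injective m
      · obtain ⟨w, mu, hmu, hw⟩ := exists_perm_eq_add_staircase hinj
        refine mul_eq_zero_of_left ?_ _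
        rw [← hsymm w]
        simp only [hw]
        by_cases hle : ∀ i, lam i ≤ mu i
        · have hsum : ∑ i, mu i ≤ ∑ i, lam i := by
            rw [← Equiv.sum_comp w] at hm
            simp only [hw, Finset.sum_add_distrib] at hm
            omega
          have heq := (Finset.sum_eq_sum_iff_of_le fun i _ => hle i).1
            (le_antisymm (Finset.sum_le_sum fun i _ => hle i) hsum)
          have : lam = mu := funext fun i => heq i (Finset.mem_univ i)
          rw [← this]
          exact h0
        · exact hvan mu hmu hle
      · refine mul_eq_zero_of_right _ ?_
        rw [alternant_eq_factorialAlternant, map_factorialAlternant]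
        refine factorialAlternant_eq_zero (fun h => hinj fun i j hij => h ?_) _ _
        simp [hij]
  set S := factorialSchur lam η with hS
  have hSdeg : S ∈ degreeLT r (∑ i, lam i + 1) := (sameTop_factorialSchur lam η).mem
  have hSsymm : ∀ (w : Equiv.Perm (Fin r)) (m : Fin r → ℕ),
      eval (fun i => η (m (w i))) S = eval (fun i => η (m i)) S := fun w m => by
    conv_rhs => rw [hS, ← rename_factorialSchur lam η w, eval_rename]
    rfl
  have hSvan : ∀ mu : Fin r → ℕ, Antitone mu → ¬ (∀ i, lam i ≤ mu i) →
      eval (fun i => η (mu i + staircase r i)) S = 0 :=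
    fun mu hmu h => eval_factorialSchur_nodes hlam hmu h hη
  -- Otherwise `key` would give `S = 0`, against its coefficient `1` at `x^λ`. Hence `c` can be
  -- taken as the ratio of the values at the node of `λ`.
  have hS0 : eval (fun i => η (lam i + staircase r i)) S ≠ 0 := fun h0 => by
    have h1 := coeff_factorialSchur hlam η
    rw [← hS, key S hSdeg hSsymm hSvan h0] at h1
    simp at h1
  refine ⟨eval (fun i => η (lam i + staircase r i)) p / eval (fun i => η (lam i + staircase r i)) S,
    sub_eq_zero.1 (key _ ?_ (fun w m => ?_) (fun mu hmu h => ?_) ?_)⟩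
  · exact Submodule.sub_mem _ hp ((SameTop.refl hSdeg).C_mul _).mem
  · rw [map_sub, map_sub, map_mul, map_mul, hsymm, hSsymm, eval_C, eval_C]
  · rw [map_sub, map_mul, hvan mu hmu h, hSvan mu hmu h]; simp
  · rw [map_sub, map_mul, eval_C, div_mul_cancel₀ _ hS0, sub_self]

lemma interpNode_self (q a : ℂ) (mu : Fin r → ℕ) :
    interpNode q q a mu = fun i => a * q ^ (mu i + staircase r i) := by
  ext i
  rw [interpNode, pow_add, mul_assoc]
  rfl

/-- For `t = q`, Okounkov's interpolation Laurent polynomials are factorial Schur polynomials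
in the `x_i + x_i⁻¹`. -/
lemma okounkovIP_self {q a : ℂ} (hq : q ≠ 0) (ha : a ≠ 0) {η : ℕ → ℂ}
    (hη : Function.Injective η) (hηdef : ∀ l, η l = a * q ^ l + (a * q ^ l)⁻¹)
    {lam : Fin r → ℕ} (hlam : Antitone lam) :
    okounkovIP q q a lam = toLaurent (factorialSchur lam η) := by
  have hne : ∀ l : ℕ, a * q ^ l ≠ 0 := fun l => mul_ne_zero ha (pow_ne_zero l hq)
  have hSdeg : factorialSchur lam η ∈ degreeLT r (∑ i, lam i + 1) :=
    (sameTop_factorialSchur lam η).mem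
  have hmonic : (toLaurent (factorialSchur lam η)).coeff (fun i => (lam i : ℤ)) = 1 := by
    have := coeff_toLaurent_top hSdeg (Finsupp.equivFunOnFinite.symm lam)
      (Finsupp.degree_eq_sum _)
    rw [coeff_factorialSchur hlam] at this
    exact this
  have hIP : IsOkounkovIP q q a lam (toLaurent (factorialSchur lam η)) :=
    { degree_le := fun m hm => by
        exact_mod_cast sum_le_of_mem_support_toLaurent hSdeg hm
      monic := hmonic
      perm_invariant := fun w m => coeff_permExponents_toLaurent w (rename_factorialSchur _ _ _) m
      inv_invariant := fun e m => coeff_signExponents_toLaurent e _ m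
      vanishing := fun mu hmu h => by
        rw [interpNode_self, laurentEval_toLaurent _ fun i => hne _]
        simp only [← hηdef]
        exact eval_factorialSchur_nodes hlam hmu h hη }
  have huniq : ∀ P, IsOkounkovIP q q a lam P → P = toLaurent (factorialSchur lam η) := by
    intro P hP
    obtain ⟨p, hp, rfl⟩ := exists_toLaurent_eq (N := ∑ i, lam i)
      (fun m hm => by exact_mod_cast hP.degree_le m hm) hP.inv_invariant
    have heval : ∀ m : Fin r → ℕ, eval (fun i => η (m i)) p =
        laurentEval (toLaurent p) fun i => a * q ^ m i := fun m => by
      rw [laurentEval_toLaurent _ fun i => hne _]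
      simp only [← hηdef]
    obtain ⟨c, hc⟩ := eq_C_mul_factorialSchur hlam hη hp
      (fun w m => by
        rw [heval, heval]
        exact laurentEval_perm hP.perm_invariant w fun i => a * q ^ m i)
      (fun mu hmu h => by
        rw [heval fun i => mu i + staircase r i, ← interpNode_self]
        exact hP.vanishing mu hmu h)
    have h1 := hP.monic
    have e : toLaurent p = c • toLaurent (factorialSchur lam η) := by
      rw [hc, ← smul_eq_C_mul, map_smul]
    rw [e, AddMonoidAlgebra.coeff_smul, Finsupp.smul_apply, hmonic, smul_eq_mul, mul_one] at h1
    rw [e, h1, one_smul]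
  have hex : ∃! P, IsOkounkovIP q q a lam P := ⟨_, hIP, huniq⟩
  rw [okounkovIP, dif_pos hex]
  exact huniq _ hex.choose_spec.1

end LaurentPolynomials

/-! ### The limit `q ↑ 1` and the continuation to all `α` -/

section Limit

open MvPolynomial

variable {r : ℕ}

/-! ### The limit `q ↑ 1` -/

lemma hasDerivAt_cpow_one (c : ℂ) : HasDerivAt (fun q : ℝ => (q : ℂ) ^ c) c 1 := by
  have h : HasDerivAt (fun z : ℂ => z ^ c) (c * (1 : ℂ) ^ (c - 1) * 1) ((1 : ℝ) : ℂ) := by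
    have := (hasDerivAt_id ((1 : ℝ) : ℂ)).cpow_const (c := c) (by simp)
    simpa using this
  simpa using h.comp_ofReal

/-- `(q^c + q^(-c) - 2) / (1 - q)^2` tends to `c ^ 2` as `q` increases to `1`. -/
lemma tendsto_cpow_add_inv (c : ℂ) :
    Tendsto (fun q : ℝ => ((q : ℂ) ^ c + ((q : ℂ) ^ c)⁻¹ - 2) / (1 - (q : ℂ)) ^ 2)
      (𝓝[<] 1) (𝓝 (c ^ 2)) := by
  -- The numerator is the square of `q^(c/2) - q^(-c/2)`, which vanishes at `1` with derivative `c`;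
  -- so the quotient is the square of a slope.
  have h1 : HasDerivAt (fun q : ℝ => (q : ℂ) ^ (c / 2) - (q : ℂ) ^ (-(c / 2))) c 1 := by
    have := (hasDerivAt_cpow_one (c / 2)).sub (hasDerivAt_cpow_one (-(c / 2)))
    rwa [sub_neg_eq_add, add_halves] at this
  have h2 := (h1.tendsto_slope.mono_left
    (nhdsWithin_mono 1 fun q (hq : q < 1) => hq.ne)).pow 2
  refine h2.congr' ?_
  have hpos : ∀ᶠ q : ℝ in 𝓝[<] 1, 0 < q :=
    nhdsWithin_le_nhds (lt_mem_nhds one_pos)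
  filter_upwards [hpos, self_mem_nhdsWithin] with q hq hq1
  have hq0 : (q : ℂ) ≠ 0 := by exact_mod_cast hq.ne'
  have e : (q : ℂ) ^ c = (q : ℂ) ^ (c / 2) * (q : ℂ) ^ (c / 2) := by
    rw [← Complex.cpow_add _ _ hq0, add_halves]
  have hne : (q : ℂ) ^ (c / 2) ≠ 0 := by simp [Complex.cpow_eq_zero_iff, hq0]
  have hq1' : (q : ℂ) - 1 ≠ 0 := by
    rw [sub_ne_zero]; exact_mod_cast (Set.mem_Iio.1 hq1).ne
  have hq1'' : 1 - (q : ℂ) ≠ 0 := by rwa [← neg_ne_zero, neg_sub]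
  rw [slope_def_module, Complex.cpow_neg, e]
  simp only [Complex.ofReal_one, Complex.one_cpow, sub_self, sub_zero, Complex.real_smul,
    Complex.ofReal_inv, Complex.ofReal_sub]
  rw [← neg_sub 1 (q : ℂ)]
  field_simp
  ring

/-- For `q < 1` close to `1`, the only solutions `q^(2 β + j) = 1` are the obvious ones. -/
lemma eventually_cpow_ne_one (beta : ℂ) (hbeta : ∀ j : ℕ, 2 * beta + j ≠ 0) :
    ∀ᶠ q : ℝ in 𝓝[<] 1, ∀ j : ℕ, (q : ℂ) ^ (2 * beta + j) ≠ 1 := by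
  have hpos : ∀ᶠ q : ℝ in 𝓝[<] 1, 0 < q :=
    nhdsWithin_le_nhds (lt_mem_nhds one_pos)
  -- A solution means `log q * (2 β + j) = 2 π i l`. The imaginary part of the left side does not
  -- involve `j`, so once it is below `2 π` in absolute value, `l = 0` for all `j` at once.
  have hlog : Tendsto (fun q : ℝ => |Real.log q * (2 * beta.im)|) (𝓝[<] 1) (𝓝 0) := by
    have : ContinuousAt (fun q : ℝ => |Real.log q * (2 * beta.im)|) 1 :=
      ((Real.continuousAt_log one_ne_zero).mul continuousAt_const).abs
    have h := this.tendsto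
    simp only [Real.log_one, zero_mul, abs_zero] at h
    exact h.mono_left nhdsWithin_le_nhds
  filter_upwards [hpos, self_mem_nhdsWithin,
    hlog.eventually (gt_mem_nhds Real.two_pi_pos)] with q hq hq1 hsmall j hj
  have hq0 : (q : ℂ) ≠ 0 := by exact_mod_cast hq.ne'
  rw [Complex.cpow_def_of_ne_zero hq0, Complex.exp_eq_one_iff] at hj
  obtain ⟨l, hl⟩ := hj
  rw [← Complex.ofReal_log hq.le] at hl
  have him := congrArg Complex.im hl
  simp only [Complex.mul_im, Complex.ofReal_re, Complex.ofReal_im] at him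
  simp at him
  have hl0 : l = 0 := by
    by_contra h0
    have h1 : (1 : ℝ) ≤ |(l : ℝ)| := by exact_mod_cast Int.one_le_abs h0
    rw [him, abs_mul, abs_of_pos Real.two_pi_pos] at hsmall
    nlinarith [Real.two_pi_pos]
  rw [hl0, Int.cast_zero, zero_mul, mul_eq_zero] at hl
  rcases hl with h | h
  · have : Real.log q ≠ 0 := (Real.log_neg hq hq1).ne
    exact this (by exact_mod_cast h)
  · exact hbeta j h

/-- `y + y⁻¹ = z + z⁻¹` forces `y = z` or `y z = 1`; the second case would read `q^(2β + k + l) =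
1`. -/
lemma injective_nodes {q : ℝ} (hq : 0 < q) (hq1 : q < 1) {beta : ℂ}
    (h : ∀ j : ℕ, (q : ℂ) ^ (2 * beta + j) ≠ 1) :
    Function.Injective fun l : ℕ => (q : ℂ) ^ (beta + l) + ((q : ℂ) ^ (beta + l))⁻¹ := by
  intro k l hkl
  have hq0 : (q : ℂ) ≠ 0 := by exact_mod_cast hq.ne'
  simp only at hkl
  have hk : (q : ℂ) ^ (beta + k) ≠ 0 := by simp [Complex.cpow_eq_zero_iff, hq0]
  have hl : (q : ℂ) ^ (beta + l) ≠ 0 := by simp [Complex.cpow_eq_zero_iff, hq0]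
  have hprod : ((q : ℂ) ^ (beta + k) - (q : ℂ) ^ (beta + l)) *
      ((q : ℂ) ^ (beta + k) * (q : ℂ) ^ (beta + l) - 1) = 0 := by
    field_simp at hkl
    linear_combination hkl
  rcases mul_eq_zero.1 hprod with h0 | h0
  · rw [Complex.cpow_add _ _ hq0, Complex.cpow_add _ _ hq0, ← mul_sub, mul_eq_zero] at h0
    have h1 := h0.resolve_left (by simp [Complex.cpow_eq_zero_iff, hq0])
    rw [Complex.cpow_natCast, Complex.cpow_natCast, sub_eq_zero] at h1
    have h2 : q ^ k = q ^ l := by exact_mod_cast h1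
    exact pow_right_injective₀ hq hq1.ne h2
  · rw [← Complex.cpow_add _ _ hq0, sub_eq_zero] at h0
    refine absurd ?_ (h (k + l))
    rw [← h0]
    push_cast
    congr 1
    ring

/-- Affine equivariance with `u = (1 - q)²`, `v = 2` moves the normalization into the arguments,
which converge one by one. -/
lemma isInterpLimit_factorialSchur {lam : Fin r → ℕ} (hlam : Antitone lam) {beta : ℂ}
    (hbeta : ∀ j : ℕ, 2 * beta + j ≠ 0) :
    IsInterpLimit 1 beta lam
      (expand 2 (factorialSchur lam fun l : ℕ => (beta + l) ^ 2)) := by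
  intro x
  have hlim : Tendsto (fun q : ℝ => eval (Sum.elim
      (fun i => ((q : ℂ) ^ x i + ((q : ℂ) ^ x i)⁻¹ - 2) / (1 - (q : ℂ)) ^ 2)
      (fun l : ℕ => ((q : ℂ) ^ (beta + l) + ((q : ℂ) ^ (beta + l))⁻¹ - 2) / (1 - (q : ℂ)) ^ 2))
      (universalFactorialSchur lam)) (𝓝[<] 1)
      (𝓝 (eval (Sum.elim (fun i => x i ^ 2) (fun l : ℕ => (beta + l) ^ 2))
        (universalFactorialSchur lam))) := by
    refine ((MvPolynomial.continuous_eval _).tendsto _).comp (tendsto_pi_nhds.2 ?_)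
    rintro (i | l)
    · exact tendsto_cpow_add_inv (x i)
    · exact tendsto_cpow_add_inv (beta + l)
  have hval : eval x (expand 2 (factorialSchur lam fun l : ℕ => (beta + l) ^ 2)) =
      eval (Sum.elim (fun i => x i ^ 2) (fun l : ℕ => (beta + l) ^ 2))
        (universalFactorialSchur lam) := by
    rw [← eval_factorialSchur, eval_expand]
    rfl
  rw [hval]
  refine hlim.congr' ?_
  have hpos : ∀ᶠ q : ℝ in 𝓝[<] 1, 0 < q :=
    nhdsWithin_le_nhds (lt_mem_nhds one_pos)
  filter_upwards [hpos, self_mem_nhdsWithin, eventually_cpow_ne_one beta hbeta] with q hq hq1 hne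
  have hq0 : (q : ℂ) ≠ 0 := by exact_mod_cast hq.ne'
  have hq1'' : 1 - (q : ℂ) ≠ 0 := by
    rw [sub_ne_zero]; exact_mod_cast (Set.mem_Iio.1 hq1).ne'
  have hu : (1 - (q : ℂ)) ^ 2 ≠ 0 := pow_ne_zero 2 hq1''
  have hc : ∀ c : ℂ, (q : ℂ) ^ c ≠ 0 := fun c => by simp [Complex.cpow_eq_zero_iff, hq0]
  rw [Complex.cpow_one, okounkovIP_self hq0 (hc beta) (injective_nodes hq hq1 hne)
    (fun l => by rw [Complex.cpow_add _ _ hq0, Complex.cpow_natCast]) hlam,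
    laurentEval_toLaurent _ fun i => hc _, ← eval_factorialSchur]
  have haff := eval_affine_factorialSchur lam
    (fun l : ℕ => ((q : ℂ) ^ (beta + l) + ((q : ℂ) ^ (beta + l))⁻¹ - 2) / (1 - (q : ℂ)) ^ 2)
    hu 2 (fun i => ((q : ℂ) ^ x i + ((q : ℂ) ^ x i)⁻¹ - 2) / (1 - (q : ℂ)) ^ 2)
  simp only [mul_div_cancel₀ _ hu, sub_add_cancel] at haff
  rw [haff, ← pow_mul, inv_mul_cancel_left₀ (pow_ne_zero _ hq1'')]

/-- The exceptional values `-j/2` accumulate only at infinity, so near `alpha` only finitely many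
`j` matter. -/
lemma eventually_generic (alpha : ℂ) : ∀ᶠ beta : ℂ in 𝓝[≠] alpha, ∀ j : ℕ, 2 * beta + j ≠ 0 := by
  obtain ⟨M, hM⟩ := exists_nat_gt (2 * (‖alpha‖ + 1))
  have h1 : ∀ᶠ beta : ℂ in 𝓝[≠] alpha, ∀ j ∈ Finset.range M, 2 * beta + (j : ℂ) ≠ 0 := by
    rw [Finset.eventually_all]
    intro j _
    have h2 : ∀ᶠ beta in 𝓝[≠] alpha, beta ≠ -(j : ℂ) / 2 := by
      rcases eq_or_ne alpha (-(j : ℂ) / 2) with h | h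
      · rw [← h]; exact self_mem_nhdsWithin
      · exact nhdsWithin_le_nhds (eventually_ne_nhds h)
    filter_upwards [h2] with beta hb h0
    exact hb (by linear_combination h0 / 2)
  have h2 : ∀ᶠ beta in 𝓝[≠] alpha, dist beta alpha < 1 :=
    nhdsWithin_le_nhds (Metric.ball_mem_nhds alpha one_pos)
  filter_upwards [h1, h2] with beta hb hd j h0
  refine hb j (Finset.mem_range.2 ?_) h0
  have h3 : (j : ℂ) = -(2 * beta) := by linear_combination h0
  have h4 : (j : ℝ) = 2 * ‖beta‖ := by
    have := congrArg norm h3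
    simpa using this
  have h5 : ‖beta‖ ≤ ‖alpha‖ + 1 := by
    have := norm_le_norm_add_norm_sub' beta alpha
    rw [dist_eq_norm] at hd
    linarith
  have : (j : ℝ) < M := by linarith
  exact_mod_cast this

/-- The generic formula is polynomial in `β`, so it extends continuously to every `alpha`,
exceptional or not. -/
lemma isBCInterp_factorialSchur {lam : Fin r → ℕ} (hlam : Antitone lam) (alpha : ℂ) :
    IsBCInterp 1 alpha lam
      (expand 2 (factorialSchur lam fun l : ℕ => (alpha + l) ^ 2)) := by
  refine ⟨fun beta => expand 2 (factorialSchur lam fun l : ℕ => (beta + l) ^ 2),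
    (eventually_generic alpha).mono fun beta h => isInterpLimit_factorialSchur hlam h,
    fun x => ?_⟩
  simp only [eval_expand, eval_factorialSchur]
  have : Continuous fun beta : ℂ => eval (Sum.elim (x ^ 2) fun l : ℕ => (beta + l) ^ 2)
      (universalFactorialSchur lam) := by
    refine (MvPolynomial.continuous_eval _).comp (continuous_pi ?_)
    rintro (i | l)
    · exact continuous_const
    · exact (continuous_id.add continuous_const).pow 2
  exact this.continuousAt.tendsto.mono_left nhdsWithin_le_nhds

lemma isBCInterp_unique {tau alpha : ℂ} {lam : Fin r → ℕ} {P P' : MvPolynomial (Fin r) ℂ}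
    (h : IsBCInterp tau alpha lam P) (h' : IsBCInterp tau alpha lam P') : P = P' := by
  obtain ⟨Q, hQ, hlim⟩ := h
  obtain ⟨Q', hQ', hlim'⟩ := h'
  refine MvPolynomial.funext fun x => ?_
  refine tendsto_nhds_unique_of_eventuallyEq (hlim x) (hlim' x) ?_
  filter_upwards [hQ, hQ'] with beta h h'
  exact tendsto_nhds_unique (h x) (h' x)

/-- For `τ = 1`, the Okounkov type BC interpolation polynomials are factorial Schur polynomials
in the squares of the variables. -/
lemma bcInterp_one {lam : Fin r → ℕ} (hlam : Antitone lam) (alpha : ℂ) :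
    bcInterp 1 alpha lam = expand 2 (factorialSchur lam fun l : ℕ => (alpha + l) ^ 2) := by
  have h := isBCInterp_factorialSchur hlam alpha
  have hex : ∃! P, IsBCInterp 1 alpha lam P := ⟨_, h, fun P hP => isBCInterp_unique hP h⟩
  rw [bcInterp, dif_pos hex]
  exact isBCInterp_unique hex.choose_spec.1 h

end Limit

/-! ### Leading parts of the Casimir polynomials -/

section Casimir

open MvPolynomial

variable {r : ℕ}

/-! ### A generating function for the Casimir eigenvalues -/

section PartialFractions

variable {n : ℕ} {y : Fin n → ℂ}

/-- Partial fractions of `1 - ∏ (1 - 1 / (X - y_j))`, cleared of denominators; the Casimir weights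
are the residues at the `y_i`. Both sides have degree below `n` and agree at the `n` points `y_k`.
-/
lemma sum_mul_prod_erase_sub (hy : Function.Injective y) :
    ∑ i, Polynomial.C (∏ j ∈ Finset.univ.erase i, (1 - 1 / (y i - y j))) *
        ∏ j ∈ Finset.univ.erase i, (Polynomial.X - Polynomial.C (y j)) =
      ∏ j, (Polynomial.X - Polynomial.C (y j)) -
        ∏ j, (Polynomial.X - Polynomial.C (y j + 1)) := by
  refine Polynomial.eq_of_degrees_lt_of_eval_index_eq Finset.univ hy.injOn ?_ ?_ fun k _ => ?_
  · rw [Finset.card_univ, Fintype.card_fin]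
    refine (Polynomial.degree_sum_le _ _).trans_lt
      ((Finset.sup_lt_iff (WithBot.bot_lt_coe n)).2 fun i _ => ?_)
    rw [← Polynomial.smul_eq_C_mul]
    refine (Polynomial.degree_smul_le _ _).trans_lt ?_
    rw [Polynomial.degree_prod]
    simp only [Polynomial.degree_X_sub_C, Finset.sum_const, Finset.card_erase_of_mem
      (Finset.mem_univ i), Finset.card_univ, Fintype.card_fin]
    have := i.pos
    rw [nsmul_one]
    exact WithBot.coe_lt_coe.2 (Nat.sub_lt this one_pos)
  · have hmonic : ∀ z : Fin n → ℂ, (∏ j, (Polynomial.X - Polynomial.C (z j))).Monic :=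
      fun z => Polynomial.monic_prod_of_monic _ _ fun j _ => Polynomial.monic_X_sub_C _
    have hdeg : ∀ z : Fin n → ℂ, (∏ j, (Polynomial.X - Polynomial.C (z j))).degree = (n : WithBot ℕ) :=
      fun z => by rw [Polynomial.degree_prod]; simp
    refine (Polynomial.degree_sub_lt_left ((hdeg _).trans (hdeg _).symm) (hmonic y).ne_zero
      ((hmonic y).leadingCoeff.trans (hmonic _).leadingCoeff.symm)).trans_le ?_
    rw [hdeg, Finset.card_univ, Fintype.card_fin]
  · rw [Polynomial.eval_finsetSum, Finset.sum_eq_single k]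
    · simp only [Polynomial.eval_mul, Polynomial.eval_C, Polynomial.eval_prod,
        Polynomial.eval_sub, Polynomial.eval_X, ← Finset.prod_mul_distrib]
      rw [← Finset.mul_prod_erase Finset.univ (fun j => y k - y j) (Finset.mem_univ k),
        ← Finset.mul_prod_erase Finset.univ (fun j => y k - (y j + 1)) (Finset.mem_univ k),
        sub_self, zero_mul, zero_sub, sub_add_cancel_left, neg_one_mul, neg_neg]
      refine Finset.prod_congr rfl fun j hj => ?_
      have : y k - y j ≠ 0 := sub_ne_zero.2 fun h => (Finset.ne_of_mem_erase hj) (hy h).symm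
      field_simp
      ring
    · intro i _ hi
      rw [Polynomial.eval_mul, Polynomial.eval_prod (Finset.univ.erase i),
        Finset.prod_eq_zero (s := Finset.univ.erase i)
          (f := fun j => Polynomial.eval (y k) (Polynomial.X - Polynomial.C (y j)))
          (Finset.mem_erase.2 ⟨hi.symm, Finset.mem_univ k⟩) (by simp), mul_zero]
    · simp

/-- The previous identity at `1 / v`, times `v^n`: now each factor `1 - y_j v` is invertible as a
power series. -/
lemma sum_mul_prod_erase_one_sub (hy : Function.Injective y) :
    Polynomial.X * ∑ i, Polynomial.C (∏ j ∈ Finset.univ.erase i, (1 - 1 / (y i - y j))) *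
        ∏ j ∈ Finset.univ.erase i, (1 - Polynomial.C (y j) * Polynomial.X) =
      ∏ j, (1 - Polynomial.C (y j) * Polynomial.X) -
        ∏ j, (1 - Polynomial.C (y j) * Polynomial.X - Polynomial.X) := by
  refine Polynomial.eq_of_infinite_eval_eq _ _
    ((Set.infinite_of_finite_compl (s := {v : ℂ | v ≠ 0}) (by simp [Set.compl_def])).mono
      fun v (hv : v ≠ 0) => ?_)
  have h := congrArg (fun p => v ^ n * Polynomial.eval v⁻¹ p) (sum_mul_prod_erase_sub hy)
  have hmul : ∀ (s : Finset (Fin n)) (f : Fin n → ℂ),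
      v ^ s.card * ∏ j ∈ s, f j = ∏ j ∈ s, (v * f j) := fun s f => by
    rw [Finset.prod_mul_distrib, Finset.prod_const]
  have hcard : ∀ i : Fin n, v ^ n = v * v ^ (Finset.univ.erase i).card := fun i => by
    rw [Finset.card_erase_of_mem (Finset.mem_univ i), Finset.card_univ, Fintype.card_fin,
      ← pow_succ', Nat.sub_add_cancel i.pos]
  have huniv : v ^ n = v ^ (Finset.univ : Finset (Fin n)).card := by simp
  simp only [Polynomial.eval_finsetSum, Polynomial.eval_mul, Polynomial.eval_C,
    Polynomial.eval_prod, Polynomial.eval_sub, Polynomial.eval_X, mul_sub, Finset.mul_sum] at h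
  simp only [Set.mem_ofPred_eq, Polynomial.eval_finsetSum, Polynomial.eval_mul, Polynomial.eval_C,
    Polynomial.eval_prod, Polynomial.eval_sub, Polynomial.eval_X, Polynomial.eval_one,
    Finset.mul_sum]
  have hL : ∀ i : Fin n, v ^ n * ((∏ j ∈ Finset.univ.erase i, (1 - 1 / (y i - y j))) *
      ∏ j ∈ Finset.univ.erase i, (v⁻¹ - y j)) =
      v * ((∏ j ∈ Finset.univ.erase i, (1 - 1 / (y i - y j))) *
        ∏ j ∈ Finset.univ.erase i, (1 - y j * v)) := fun i => by
    rw [hcard i, mul_assoc, mul_left_comm (v ^ _), hmul]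
    congr 2
    refine Finset.prod_congr rfl fun j _ => ?_
    field_simp
  rw [Finset.sum_congr rfl fun i _ => hL i, huniv, hmul, hmul] at h
  rw [h]
  congr 1 <;> refine Finset.prod_congr rfl fun j _ => ?_
  · field_simp
  · field_simp
    ring

end PartialFractions

/-- The power series `1 - ∏ (1 - v / (1 - y_j v))` in `v`. -/
def casimirSeries {R : Type*} [CommRing R] {n : ℕ} (y : Fin n → R) : PowerSeries R :=
  1 - ∏ j, (1 - PowerSeries.X * PowerSeries.mk fun p => y j ^ p)

/-- Division by `∏ (1 - y_j v)` gives `∑ w_i v / (1 - y_i v)`, with `w_i` the Casimir weights. The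
rational expression in the `y_i` is thereby seen to be a polynomial. -/
lemma coeff_casimirSeries {n : ℕ} {y : Fin n → ℂ} (hy : Function.Injective y) (p : ℕ) :
    PowerSeries.coeff (p + 1) (casimirSeries y) =
      ∑ i, (∏ j ∈ Finset.univ.erase i, (1 - 1 / (y i - y j))) * y i ^ p := by
  have h := sum_mul_prod_erase_one_sub hy
  -- The weights are made opaque so that `simp` does not push the ring maps inside them.
  obtain ⟨w, hw⟩ : ∃ w : Fin n → ℂ, ∀ i, ∏ j ∈ Finset.univ.erase i, (1 - 1 / (y i - y j)) = w i :=
    ⟨_, fun i => rfl⟩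
  simp only [hw] at h ⊢
  replace h := congrArg (Polynomial.coeToPowerSeries.ringHom (R := ℂ)) h
  simp only [map_mul, map_sum, map_prod, map_sub, map_one,
    Polynomial.coeToPowerSeries.ringHom_apply, Polynomial.coe_C, Polynomial.coe_X] at h
  have hG : ∀ j, (1 - PowerSeries.C (y j) * PowerSeries.X) *
      (PowerSeries.mk fun p => y j ^ p) = 1 := fun j => by
    ext m
    rw [sub_mul, one_mul, mul_assoc, map_sub, PowerSeries.coeff_C_mul, PowerSeries.coeff_one]
    rcases m with _ | m
    · simp
    · rw [PowerSeries.coeff_succ_X_mul]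
      simp [pow_succ']
  have key : casimirSeries y = PowerSeries.X * ∑ i,
      PowerSeries.C (w i) * PowerSeries.mk fun p => y i ^ p := by
    have h' := congrArg (fun f => f * ∏ j, (PowerSeries.mk fun p => y j ^ p)) h
    simp only [sub_mul _ _ (∏ j, PowerSeries.mk fun p => y j ^ p), ← Finset.prod_mul_distrib, hG,
      Finset.prod_const_one, sub_mul _ PowerSeries.X (PowerSeries.mk _)] at h'
    rw [casimirSeries, ← h', mul_assoc, Finset.sum_mul]
    congr 1
    refine Finset.sum_congr rfl fun i _ => ?_
    rw [mul_assoc]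
    congr 1
    rw [← Finset.mul_prod_erase Finset.univ (fun j => PowerSeries.mk fun p => y j ^ p)
      (Finset.mem_univ i), mul_left_comm, ← Finset.prod_mul_distrib,
      Finset.prod_congr rfl fun j _ => hG j, Finset.prod_const_one, mul_one]
  rw [key, PowerSeries.coeff_succ_X_mul, map_sum]
  simp [PowerSeries.coeff_C_mul]

lemma map_casimirSeries {R S : Type*} [CommRing R] [CommRing S] (φ : R →+* S) {n : ℕ}
    (y : Fin n → R) : PowerSeries.map φ (casimirSeries y) = casimirSeries fun j => φ (y j) := by
  have h : ∀ j, PowerSeries.map φ (PowerSeries.mk fun p => y j ^ p) =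
      PowerSeries.mk fun p => φ (y j) ^ p := fun j => by
    ext p; simp
  simp [casimirSeries, h]

/-- The power series whose `m`-th coefficient has degree less than `m - d`. -/
def seriesDegreeLT (r d : ℕ) : AddSubgroup (PowerSeries (MvPolynomial (Fin r) ℂ)) where
  carrier := {φ | ∀ m, PowerSeries.coeff m φ ∈ degreeLT r (m - d)}
  zero_mem' m := by simp
  add_mem' hφ hψ m := by rw [map_add]; exact Submodule.add_mem _ (hφ m) (hψ m)
  neg_mem' hφ m := by rw [map_neg]; exact Submodule.neg_mem _ (hφ m)

lemma seriesDegreeLT_anti {d e : ℕ} (h : d ≤ e) : seriesDegreeLT r e ≤ seriesDegreeLT r d :=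
  fun _ hφ m => degreeLT_mono (by omega) (hφ m)

/-- Degrees below `a` and below `b` give a product of degree at most `a + b - 2`: one order is
gained. -/
lemma mul_mem_seriesDegreeLT {φ ψ : PowerSeries (MvPolynomial (Fin r) ℂ)}
    (hφ : φ ∈ seriesDegreeLT r 0) (hψ : ψ ∈ seriesDegreeLT r 0) :
    φ * ψ ∈ seriesDegreeLT r 1 := fun m => by
  rw [PowerSeries.coeff_mul]
  refine Submodule.sum_mem _ fun ab hab => ?_
  obtain ⟨a, b⟩ := ab
  replace hab := Finset.HasAntidiagonal.mem_antidiagonal.1 hab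
  simp only at hab ⊢
  rcases b with _ | b
  -- The bound for the coefficient of index `0` is degree `< 0`, so it vanishes.
  · have h0 : PowerSeries.coeff 0 ψ = 0 := by
      have := mem_degreeLT.1 (hψ 0)
      rw [← support_eq_empty]
      exact Finset.eq_empty_of_forall_notMem fun m hm => absurd (this m hm) (by simp)
    rw [h0, mul_zero]
    exact Submodule.zero_mem _
  · have := mul_mem_degreeLT (hφ a) (hψ (b + 1))
    rw [← hab]
    exact this

/-- Products of two or more `φ i` lie one step deeper in the filtration, so only the linear part
survives. -/
lemma prod_one_sub_mem {ι : Type*} (s : Finset ι)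
    {φ : ι → PowerSeries (MvPolynomial (Fin r) ℂ)} (h : ∀ i, φ i ∈ seriesDegreeLT r 0) :
    ∏ i ∈ s, (1 - φ i) - (1 - ∑ i ∈ s, φ i) ∈ seriesDegreeLT r 1 := by
  classical
  induction s using Finset.induction_on with
  | empty => simp
  | insert a s ha ih =>
    rw [Finset.prod_insert ha, Finset.sum_insert ha]
    have e : (1 - φ a) * ∏ i ∈ s, (1 - φ i) - (1 - (φ a + ∑ i ∈ s, φ i)) =
        (∏ i ∈ s, (1 - φ i) - (1 - ∑ i ∈ s, φ i)) -
          φ a * ((∏ i ∈ s, (1 - φ i) - (1 - ∑ i ∈ s, φ i)) - ∑ i ∈ s, φ i) := by ring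
    rw [e]
    exact AddSubgroup.sub_mem _ ih (mul_mem_seriesDegreeLT (h a)
      (AddSubgroup.sub_mem _ (seriesDegreeLT_anti zero_le_one ih)
        (AddSubgroup.sum_mem _ fun i _ => h i)))

/-- The leading terms of the coefficients of the Casimir generating function are power sums. -/
lemma sameTop_coeff_casimirSeries {n : ℕ} {y w : Fin n → MvPolynomial (Fin r) ℂ}
    (h : ∀ j, SameTop 1 (y j) (w j)) (p : ℕ) :
    SameTop p (PowerSeries.coeff (p + 1) (casimirSeries y)) (∑ j, w j ^ p) := by
  have hpow : ∀ j m, SameTop m (y j ^ m) (w j ^ m) := fun j m => by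
    simpa using (h j).pow m
  have hmem : ∀ j, PowerSeries.X * (PowerSeries.mk fun p => y j ^ p) ∈ seriesDegreeLT r 0 := by
    intro j m
    rcases m with _ | m
    · simp
    · rw [PowerSeries.coeff_succ_X_mul, PowerSeries.coeff_mk]
      exact (hpow j m).mem
  have h1 := prod_one_sub_mem Finset.univ hmem (p + 1)
  have h2 : SameTop p (∑ j, y j ^ p) (∑ j, w j ^ p) := SameTop.sum _ fun j _ => hpow j p
  refine SameTop.trans ?_ h2
  rw [← neg_mem_iff] at h1
  have e : -PowerSeries.coeff (p + 1)
      (∏ j, (1 - PowerSeries.X * PowerSeries.mk fun p => y j ^ p) -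
        (1 - ∑ j, PowerSeries.X * PowerSeries.mk fun p => y j ^ p)) =
      PowerSeries.coeff (p + 1) (casimirSeries y) - ∑ j, y j ^ p := by
    have : ∑ j, y j ^ p = PowerSeries.coeff (p + 1)
        (∑ j, PowerSeries.X * PowerSeries.mk fun p => y j ^ p) := by
      simp [PowerSeries.coeff_succ_X_mul]
    rw [this, casimirSeries, ← map_neg, ← map_sub]
    congr 1
    ring
  rw [e, Nat.add_sub_cancel] at h1
  refine ⟨?_, h1⟩
  have := Submodule.add_mem _ (degreeLT_mono p.le_succ h1) h2.mem
  simpa using this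

/-! ### The restricted Casimir polynomials -/

/-- The weight `(x_1, …, x_r, 0, …, 0, -x_r, …, -x_1)` with indeterminate coordinates. -/
def weightPolynomial (n r : ℕ) : Fin n → MvPolynomial (Fin r) ℂ := fun i =>
  if h : (i : ℕ) < r then X ⟨i, h⟩
  else if h' : n - 1 - (i : ℕ) < r then -X ⟨n - 1 - (i : ℕ), h'⟩
  else 0

lemma eval_weightPolynomial (n : ℕ) (x : Fin r → ℂ) (i : Fin n) :
    eval x (weightPolynomial n r i) = restrictedWeight n x i := by
  rw [weightPolynomial, restrictedWeight]
  split_ifs <;> simp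

/-- The shifted coordinates of the weight `(x_1, …, x_r, 0, …, 0, -x_r, …, -x_1)`. -/
def shiftedWeightPolynomial (n r : ℕ) (i : Fin n) : MvPolynomial (Fin r) ℂ :=
  weightPolynomial n r i + C (rhoCoord n i + ((n : ℂ) - 1) / 2)

lemma sameTop_shiftedWeightPolynomial (n : ℕ) (i : Fin n) :
    SameTop 1 (shiftedWeightPolynomial n r i) (weightPolynomial n r i) := by
  have h : weightPolynomial n r i ∈ degreeLT r 2 := by
    rw [weightPolynomial]
    split_ifs
    · exact X_mem_degreeLT _
    · exact Submodule.neg_mem _ (X_mem_degreeLT _)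
    · exact Submodule.zero_mem _
  refine ⟨Submodule.add_mem _ h (C_mem_degreeLT _), ?_⟩
  rw [shiftedWeightPolynomial, add_sub_cancel_left]
  exact C_mem_degreeLT _

lemma exists_real_restrictedWeight (n : ℕ) {x : Fin r → ℝ} (hx : Antitone x)
    (hx0 : ∀ i, 0 ≤ x i) :
    ∃ w : Fin n → ℝ, Antitone w ∧ ∀ i, restrictedWeight n (fun i => (x i : ℂ)) i = w i := by
  refine ⟨fun i => if h : (i : ℕ) < r then x ⟨i, h⟩
    else if h' : n - 1 - (i : ℕ) < r then -x ⟨n - 1 - (i : ℕ), h'⟩ else 0, ?_, fun i => ?_⟩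
  · intro i j hij
    have hij' : (i : ℕ) ≤ j := hij
    have hj := j.2
    simp only
    by_cases hj1 : (j : ℕ) < r
    · rw [dif_pos hj1, dif_pos (by omega : (i : ℕ) < r)]
      exact hx (Fin.le_def.2 hij')
    rw [dif_neg hj1]
    by_cases hi1 : (i : ℕ) < r
    · rw [dif_pos hi1]
      refine le_trans ?_ (hx0 _)
      split_ifs
      · exact neg_nonpos.2 (hx0 _)
      · exact le_rfl
    rw [dif_neg hi1]
    by_cases hi2 : n - 1 - (i : ℕ) < r
    · rw [dif_pos hi2, dif_pos (by omega : n - 1 - (j : ℕ) < r)]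
      exact neg_le_neg (hx (Fin.le_def.2 (by simp only; omega)))
    rw [dif_neg hi2]
    split_ifs
    · exact neg_nonpos.2 (hx0 _)
    · exact le_rfl
  · simp only [restrictedWeight]
    split_ifs <;> simp

/-- On the cone the weight is real and weakly decreasing, and `ρ` is strictly decreasing; the
shifted coordinates are thus distinct and `coeff_casimirSeries` applies. -/
lemma eval_coeff_casimirSeries (n p : ℕ) {x : Fin r → ℝ}
    (hx : Antitone x) (hx0 : ∀ i, 0 ≤ x i) :
    eval (fun i => (x i : ℂ))
        (PowerSeries.coeff (p + 1) (casimirSeries (shiftedWeightPolynomial n r))) =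
      casimirEigenvalue n p (restrictedWeight n fun i => (x i : ℂ)) := by
  obtain ⟨w, hw, hxw⟩ := exists_real_restrictedWeight n hx hx0
  have hy : ∀ i, eval (fun i => (x i : ℂ)) (shiftedWeightPolynomial n r i) =
      (w i : ℂ) + rhoCoord n i + ((n : ℂ) - 1) / 2 := fun i => by
    rw [shiftedWeightPolynomial, map_add, eval_weightPolynomial, hxw, eval_C, add_assoc]
  have hlt : ∀ i j : Fin n, i < j → (w i : ℂ) + rhoCoord n i + ((n : ℂ) - 1) / 2 ≠
      (w j : ℂ) + rhoCoord n j + ((n : ℂ) - 1) / 2 := fun i j hij h => by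
    have h1 : ((w i - w j + ((j : ℝ) - (i : ℝ)) : ℝ) : ℂ) = 0 := by
      simp only [rhoCoord] at h
      push_cast
      linear_combination h
    have h2 : w i - w j + ((j : ℝ) - (i : ℝ)) = 0 := by exact_mod_cast h1
    have h3 : (i : ℝ) < j := by exact_mod_cast hij
    linarith [hw hij.le]
  have hinj : Function.Injective fun i : Fin n =>
      (w i : ℂ) + rhoCoord n i + ((n : ℂ) - 1) / 2 := fun i j h => by
    rcases lt_trichotomy i j with h' | h' | h'
    · exact absurd h (hlt i j h')
    · exact h'
    · exact absurd h.symm (hlt j i h')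
  rw [← PowerSeries.coeff_map, map_casimirSeries]
  simp only [hy]
  rw [coeff_casimirSeries hinj, casimirEigenvalue]
  refine Finset.sum_congr rfl fun i _ => ?_
  rw [hxw]
  congr 1
  refine Finset.prod_congr rfl fun j _ => ?_
  rw [hxw]
  congr 2
  ring

/-- The cone `x_1 ≥ … ≥ x_r ≥ 0` is Zariski dense. -/
lemma eq_of_eval_eq_on_cone {P Q : MvPolynomial (Fin r) ℂ}
    (h : ∀ x : Fin r → ℝ, Antitone x → (∀ i, 0 ≤ x i) →
      eval (fun i => (x i : ℂ)) P = eval (fun i => (x i : ℂ)) Q) : P = Q := by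
  -- The sides `(r - i, r - i + 1)` are infinite, and their product lies inside the cone.
  refine MvPolynomial.funext_set
    (fun i : Fin r => Complex.ofReal '' Set.Ioo (r - i : ℝ) (r - i + 1)) (fun i => ?_) ?_
  · exact (Set.Ioo_infinite (by linarith)).image Complex.ofReal_injective.injOn
  · intro z hz
    choose x hx hxz using fun i => hz i (Set.mem_univ i)
    have e : z = fun i => (x i : ℂ) := funext fun i => (hxz i).symm
    rw [e]
    refine h x (fun i j hij => ?_) fun i => ?_
    · rcases hij.eq_or_lt with rfl | hlt
      · exact le_rfl
      · have h1 : (i : ℝ) + 1 ≤ j := by exact_mod_cast hlt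
        linarith [(hx i).1, (hx j).2]
    · have h1 : (i : ℝ) < r := by exact_mod_cast i.2
      linarith [(hx i).1]

lemma restrictedCasimir_eq (n p : ℕ) :
    restrictedCasimir n r p =
      PowerSeries.coeff (p + 1) (casimirSeries (shiftedWeightPolynomial n r)) := by
  have huniq : ∀ P : MvPolynomial (Fin r) ℂ, (∀ x : Fin r → ℝ, Antitone x → (∀ i, 0 ≤ x i) →
      eval (fun i => (x i : ℂ)) P =
        casimirEigenvalue n p (restrictedWeight n fun i => (x i : ℂ))) →
      P = PowerSeries.coeff (p + 1) (casimirSeries (shiftedWeightPolynomial n r)) :=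
    fun P hP => eq_of_eval_eq_on_cone fun x hx hx0 => by
      rw [hP x hx hx0, eval_coeff_casimirSeries n p hx hx0]
  have hex : ∃! P : MvPolynomial (Fin r) ℂ, ∀ x : Fin r → ℝ, Antitone x → (∀ i, 0 ≤ x i) →
      eval (fun i => (x i : ℂ)) P =
        casimirEigenvalue n p (restrictedWeight n fun i => (x i : ℂ)) :=
    ⟨_, fun x hx hx0 => eval_coeff_casimirSeries n p hx hx0, huniq⟩
  rw [restrictedCasimir, dif_pos hex]
  exact huniq _ hex.choose_spec.1

/-- Each variable occurs once as `x_i` and once as `-x_i`, at distinct positions because `2 r ≤ n`;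
even powers agree, and the zeros contribute nothing as `k > 0`. -/
lemma sum_weightPolynomial_pow {n : ℕ} (hn : 2 * r ≤ n) {k : ℕ} (hk : 0 < k) :
    ∑ j, weightPolynomial n r j ^ (2 * k) = expand 2 (C 2 * psum (Fin r) ℂ k) := by
  have h0 : ∀ j : Fin n, weightPolynomial n r j ^ (2 * k) =
      (if h : (j : ℕ) < r then (X ⟨j, h⟩ : MvPolynomial (Fin r) ℂ) ^ (2 * k) else 0) +
      (if h : (j.rev : ℕ) < r then (X ⟨j.rev, h⟩ : MvPolynomial (Fin r) ℂ) ^ (2 * k) else 0) := by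
    intro j
    have hj := j.2
    have e : n - 1 - (j : ℕ) = j.rev := by rw [Fin.val_rev]; omega
    have hrev := Fin.val_rev j
    rw [weightPolynomial]
    simp only [e]
    split_ifs with h1 h2 h2
    · omega
    · simp
    · simp [(even_two_mul k).neg_pow]
    · simp [hk.ne']
  have h1 : ∑ j : Fin n, (if h : (j : ℕ) < r then
      (X ⟨j, h⟩ : MvPolynomial (Fin r) ℂ) ^ (2 * k) else 0) = ∑ i : Fin r, X i ^ (2 * k) := by
    obtain ⟨d, rfl⟩ : ∃ d, n = r + d := Nat.exists_eq_add_of_le (by omega)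
    rw [Fin.sum_univ_add]
    simp
  have h2 : ∑ j : Fin n, (if h : (j.rev : ℕ) < r then
      (X ⟨j.rev, h⟩ : MvPolynomial (Fin r) ℂ) ^ (2 * k) else 0) = ∑ i : Fin r, X i ^ (2 * k) := by
    rw [← h1, ← Equiv.sum_comp Fin.revPerm]
    simp
  rw [Finset.sum_congr rfl fun j _ => h0 j, Finset.sum_add_distrib, h1, h2, map_mul, psum, map_sum,
    expand_C]
  have hC : (C 2 : MvPolynomial (Fin r) ℂ) = 2 := map_ofNat C 2
  simp [← two_mul, pow_mul, hC]

/-- The leading term of `C_{2k}` is `2 p_k(x_1², …, x_r²)`. -/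
lemma sameTop_restrictedCasimir {n : ℕ} (hn : 2 * r ≤ n) {k : ℕ} (hk : 0 < k) :
    SameTop (2 * k) (restrictedCasimir n r (2 * k)) (expand 2 (C 2 * psum (Fin r) ℂ k)) := by
  rw [restrictedCasimir_eq, ← sum_weightPolynomial_pow hn hk]
  exact sameTop_coeff_casimirSeries (sameTop_shiftedWeightPolynomial n) _

/-- Each part of `μ` contributes a factor `2`, which explains the denominators `2^ℓ(μ)` in the
theorem. -/
lemma sameTop_restrictedCasimirTwice {n : ℕ} (hn : 2 * r ≤ n) {d : ℕ} (mu : d.Partition) :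
    SameTop (2 * d) (restrictedCasimirTwice n r mu)
      (C (2 ^ mu.parts.card) * expand 2 (psumPart (Fin r) ℂ mu)) := by
  have h := SameTop.multiset_prod mu.parts (d := fun k => 2 * k)
    (f := fun k => restrictedCasimir n r (2 * k))
    (g := fun k => expand 2 (C 2 * psum (Fin r) ℂ k))
    fun k hk => sameTop_restrictedCasimir hn (mu.parts_pos hk)
  have e1 : (mu.parts.map fun k => 2 * k).sum = 2 * d := by
    rw [Multiset.sum_map_mul_left, Multiset.map_id', mu.parts_sum]
  have e2 : (mu.parts.map fun k => expand 2 (C 2 * psum (Fin r) ℂ k)).prod =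
      C (2 ^ mu.parts.card) * expand 2 (psumPart (Fin r) ℂ mu) := by
    simp only [map_mul, Multiset.prod_map_mul, psumPart, map_multiset_prod, Multiset.map_map]
    simp
  rw [e1, e2] at h
  exact h

/-! ### Comparison of the leading terms -/

lemma sameTop_shiftByRho (n : ℕ) {N : ℕ} {P : MvPolynomial (Fin r) ℂ}
    (hP : P ∈ degreeLT r (N + 1)) : SameTop N (shiftByRho n P) P := by
  have h := sameTop_aeval (fun i => SameTop.X_add_C i (rhoCoord n i)) hP one_pos
  rw [one_mul, aeval_X_left, AlgHom.id_apply] at h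
  exact h

lemma sameTop_expand {N d : ℕ} (hd : 0 < d) {p h : MvPolynomial (Fin r) ℂ} (H : SameTop N p h) :
    SameTop (d * N) (expand d p) (expand d h) := by
  have hX : ∀ i : Fin r, SameTop d (X i ^ d : MvPolynomial (Fin r) ℂ) (X i ^ d) := fun i => by
    simpa using (SameTop.refl (X_mem_degreeLT i)).pow d
  refine ⟨(sameTop_aeval hX H.mem hd).mem, ?_⟩
  rw [← map_sub]
  exact aeval_mem_degreeLT (fun i => (hX i).mem) H.sub_mem hd

end Casimir

end OkounkovCasimir

end

/-! ### Comparison of the two leading parts -/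

theorem mainTheorem1 (n r : ℕ) (hn : 2 * r ≤ n) (s : ℂ)
    (lam : Fin r → ℕ) (hlam : Antitone lam)
    (a : (∑ i, lam i).Partition → ℂ)
    (ha : OkounkovCasimir.schurPolynomial lam =
      ∑ mu : (∑ i, lam i).Partition,
        MvPolynomial.C (a mu) * MvPolynomial.psumPart (Fin r) ℂ mu) :
    ∃ L : MvPolynomial (Fin r) ℂ,
      (∀ m ∈ L.support, m.degree < 2 * ∑ i, lam i) ∧
      OkounkovCasimir.shiftByRho n
          (OkounkovCasimir.bcInterp 1 (s - ((n : ℂ) - 1) / 2) lam) =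
        ∑ mu : (∑ i, lam i).Partition,
          MvPolynomial.C (a mu / 2 ^ mu.parts.card) *
            OkounkovCasimir.restrictedCasimirTwice n r mu + L := by
  open OkounkovCasimir MvPolynomial in
  -- The parameter `s` enters only through the shifts, so it is invisible in the top part `s_λ(x²)`.
  have h1 := sameTop_expand two_pos (sameTop_factorialSchur lam
    fun l : ℕ => (s - ((n : ℂ) - 1) / 2 + l) ^ 2)
  rw [← bcInterp_one hlam] at h1
  have h2 := (sameTop_shiftByRho n h1.mem).trans h1
  have h3 : SameTop (2 * ∑ i, lam i)
      (∑ mu : (∑ i, lam i).Partition,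
        C (a mu / 2 ^ mu.parts.card) * restrictedCasimirTwice n r mu)
      (expand 2 (schurPolynomial lam)) := by
    rw [ha, map_sum]
    refine SameTop.sum _ fun mu _ => ?_
    have := (sameTop_restrictedCasimirTwice hn mu).C_mul (a mu / 2 ^ mu.parts.card)
    rw [← mul_assoc, ← C_mul, div_mul_cancel₀ _ (pow_ne_zero _ two_ne_zero)] at this
    rwa [map_mul, expand_C]
  exact ⟨_, mem_degreeLT.1 (h2.trans h3.symm).sub_mem, (add_sub_cancel _ _).symm⟩
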